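/- **Setting.** Let $N\ge 1$, let $\Omega\subset\mathbb R^N$ be open, $T>0$, $Q_T=\Omega\times(0,T]$, let $B$ be the open unit ball of $\mathbb R^N$, and let $\mathbb S^N$ be the real symmetric $N\times N$ matrices. Let $\{\mu_x\}_{x\in\Omega}$ be nonnegative Borel measures on $\mathbb R^N$ and $F:\Omega\times[0,T]\times\mathbb R^N\times\mathbb S^N\times\mathbb R\to\mathbb R$. Consider $$u_t+F(x,t,Du,D^2u,\mathcal I[x,t,u])=0,\qquad \mathcal I[x,t,u]=\int_{\mathbb R^N}\big(u(x+z,t)-u(x,t)-Du(x,t)\cdot z\,1_B(z)\big)\,\mu_x(dz).\tag{1}$$ **Subsolutions.** Fix $0<\delta<1$ and put $$\mathcal I^1_\delta[x,t,\phi]=\int_{|z|\le\delta}\big(\phi(x+z,t)-\phi(x,t)-D\phi(x,t)\cdot z\,1_B(z)\big)\mu_x(dz),$$ $$\mathcal I^2_\delta[x,t,p,u]=\int_{|z|>\delta}\big(u(x+z,t)-u(x,t)-p\cdot z\,1_B(z)\big)\mu_x(dz).$$ A function $u:\mathbb R^N\times[0,T]\to\mathbb R$ satisfies the subsolution inequality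 at $(x,t)$ if, for every $\phi\in C^2$ such that $u-\phi$ has a global maximum over $\mathbb R^N\times[0,T]$ at $(x,t)$, the integral $\mathcal I^2_\delta[x,t,D\phi(x,t),u]$ converges and $$\phi_t(x,t)+F\big(x,t,D\phi(x,t),D^2\phi(x,t),\mathcal I^1_\delta[x,t,\phi]+\mathcal I^2_\delta[x,t,D\phi(x,t),u]\big)\le 0 .$$ A viscosity subsolution of (1) in $\Omega\times(0,T)$ is an upper semicontinuous $u:\mathbb R^N\times[0,T]\to\mathbb R$ satisfying this inequality at every point of $\Omega\times(0,T)$. **Assumptions.** There is a constant $\tilde C_\mu>0$ such that the following hold; in (S), (N) and (S') only $x\in\Omega$ and $t\in[0,T]$ are considered. - (M) $\int_B|z|^2\mu_x(dz)+\mu_x(\mathbb R^N\setminus B)\le\tilde C_\mu$ for all $x\in\Omega$. - (E) $F$ is continuous, and $F(x,t,p,X,l_1)\le F(x,t,p,Y,l_2)$ whenever $X\ge Y$, $l_1\ge l_2$, $p\ne0$, $(x,t)\in\Omega\times[0,T]$. - (N) For all $\bar x\in\Omega$, $0<t_0<T$ there are $R_0>0$ and $0\le\eta<1$ such that for all $0<R<R_0$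 and $c>0$ $$F\Big(x,t,p,I-\gamma p\otimes p,\ \tilde C_\mu-c\gamma\int_{\mathcal C_{\eta,\gamma}(p)}|p\cdot z|^2\mu_x(dz)\Big)\to+\infty\quad\text{as }\gamma\to+\infty,$$ uniformly in $|x-\bar x|\le R$, $|t-t_0|\le R$, $R/2\le|p|\le R$, where $\mathcal C_{\eta,\gamma}(p)=\{z:(1-\eta)|z||p|\le|p\cdot z|\le1/\gamma\}$. - (S) For all $\bar x\in\Omega$, $0<t_0<T$ there are $R_0,\varepsilon_0,\gamma_0>0$ such that for all $0<R<R_0$, $0<\varepsilon<\varepsilon_0$, $\gamma\ge\gamma_0$, $|x-\bar x|\le R$, $|t-t_0|\le R$, $R/2\le|p|\le R$, $l\in\mathbb R$, $$F(x,t,\varepsilon p,\varepsilon(I-\gamma p\otimes p),\varepsilon l)\ge\varepsilon F(x,t,p,I-\gamma p\otimes p,l).$$ - (N') For every $(x_0,t_0)\in Q_T$ there is $\lambda>0$ with $\lambda+F(x_0,t_0,0,I,\tilde C_\mu)>0$. - (S') For every $(x_0,t_0)\in Q_T$ there are $r_0,\varepsilon_0>0$ such that for all $0<\varepsilon<\varepsilon_0$,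 $0<r<r_0$, $(x,t)\in B((x_0,t_0),r)$, $|p|\le r$, $l\le\tilde C_\mu$, $$F(x,t,\varepsilon p,\varepsilon I,\varepsilon l)\ge\varepsilon F(x,t,p,I,l).$$ **Theorem (Strong Maximum Principle).** Assume (M), (E), (S), (S'), (N), (N'). Let $u$ be a viscosity subsolution of (1) in $\Omega\times(0,T)$ that attains its global maximum over $\mathbb R^N\times[0,T]$ at $P_0=(x_0,t_0)\in Q_T$; if $t_0=T$, assume also that $u$ satisfies the subsolution inequality at every point of $\Omega\times\{T\}$. Then $u\equiv u(P_0)$ on $S(P_0)$, the set consisting of $P_0$ and all points $Q\in Q_T$ that can be joined to $P_0$ by a simple continuous curve in $Q_T$ along which the time coordinate is nondecreasing from $Q$ to $P_0$. -/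

import Mathlib

open MeasureTheory Set

namespace NonlocalSMP

noncomputable section

/-- The space `ℝ^N` with its Euclidean norm. -/
abbrev E (N : ℕ) := EuclideanSpace ℝ (Fin N)

/-- Real `N × N` matrices; the symmetric ones among them form `𝕊^N`. -/
abbrev Mat (N : ℕ) := Matrix (Fin N) (Fin N) ℝ

/-- The type of nonlinearities `F(x, t, p, X, l)`. Only the values with `x ∈ Ω`, `t ∈ [0, T]` and
`X` symmetric are ever used: such an `F` stands for a real function on `Ω × [0,T] × ℝ^N × 𝕊^N × ℝ`. -/
abbrev Nonlinearity (N : ℕ) := E N → ℝ → E N → Mat N → ℝ → ℝ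

/-- The matrix `p ⊗ p`. -/
def tensorSq {N : ℕ} (p : E N) : Mat N := Matrix.vecMulVec p.ofLp p.ofLp

/-- The Hessian matrix of `f` at `x`. -/
def hessian {N : ℕ} (f : E N → ℝ) (x : E N) : Mat N :=
  Matrix.of fun i j =>
    fderiv ℝ (fderiv ℝ f) x (EuclideanSpace.single i 1) (EuclideanSpace.single j 1)

/-- The parabolic cylinder `Q_T = Ω × (0, T]`. -/
def cylinder {N : ℕ} (Ω : Set (E N)) (T : ℝ) : Set (E N × ℝ) := Ω ×ˢ Ioc 0 T

/-- The compensator `p · z 1_B(z)`, with `B` the open unit ball. -/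
def compensator {N : ℕ} (p z : E N) : ℝ :=
  indicator (Metric.ball (0 : E N) 1) (fun w => inner ℝ p w) z

/-- The increment `w(x+z) - w(x) - p · z 1_B(z)`. -/
def increment {N : ℕ} (w : E N → ℝ) (x p z : E N) : ℝ :=
  w (x + z) - w x - compensator p z

/-- The near part `∫_{|z| ≤ δ} (w(x+z) - w(x) - Dw(x) · z 1_B(z)) ν(dz)`. -/
def nearIntegral {N : ℕ} (ν : Measure (E N)) (δ : ℝ) (w : E N → ℝ) (x : E N) : ℝ :=
  ∫ z in {z : E N | ‖z‖ ≤ δ}, increment w x (gradient w x) z ∂ν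

/-- The far part `∫_{|z| > δ} (w(x+z) - w(x) - p · z 1_B(z)) ν(dz)`. -/
def farIntegral {N : ℕ} (ν : Measure (E N)) (δ : ℝ) (p : E N) (w : E N → ℝ) (x : E N) : ℝ :=
  ∫ z in {z : E N | δ < ‖z‖}, increment w x p z ∂ν

/-- The viscosity subsolution property of `u : ℝ^N × [0,T] → ℝ` at the point `(x, t)`, for
`u_t + F(x, t, Du, D²u, I[x, t, u]) = 0`, with splitting radius `δ` of the nonlocal term: whenever
`φ` is of class `C²` and `u - φ` has a global maximum over `ℝ^N × [0,T]` at `(x, t)`, the far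
integral of `u` converges and the viscosity inequality holds. -/
def IsSubsolutionAt {N : ℕ} (F : Nonlinearity N) (μ : E N → Measure (E N)) (T δ : ℝ)
    (u : E N × ℝ → ℝ) (x : E N) (t : ℝ) : Prop :=
  ∀ φ : E N × ℝ → ℝ, ContDiff ℝ 2 φ →
    (∀ y : E N, ∀ s ∈ Icc 0 T, u (y, s) - φ (y, s) ≤ u (x, t) - φ (x, t)) →
    IntegrableOn (increment (fun y => u (y, t)) x (gradient (fun y => φ (y, t)) x))
        {z : E N | δ < ‖z‖} (μ x) ∧
      deriv (fun s => φ (x, s)) t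
        + F x t (gradient (fun y => φ (y, t)) x) (hessian (fun y => φ (y, t)) x)
            (nearIntegral (μ x) δ (fun y => φ (y, t)) x
              + farIntegral (μ x) δ (gradient (fun y => φ (y, t)) x) (fun y => u (y, t)) x)
        ≤ 0

/-- Upper semicontinuous viscosity subsolutions of
`u_t + F(x, t, Du, D²u, I[x, t, u]) = 0` in `Ω × (0, T)`. -/
structure IsViscositySubsolution {N : ℕ} (F : Nonlinearity N) (μ : E N → Measure (E N))
    (Ω : Set (E N)) (T δ : ℝ) (u : E N × ℝ → ℝ) : Prop where
  usc : UpperSemicontinuousOn u (univ ×ˢ Icc 0 T)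
  subsolutionAt : ∀ x ∈ Ω, ∀ t ∈ Ioo 0 T, IsSubsolutionAt F μ T δ u x t

/-- Condition (M): `∫_B |z|² μ_x(dz) + μ_x(ℝ^N \ B) ≤ C` for all `x ∈ Ω`. -/
def CondM {N : ℕ} (Ω : Set (E N)) (μ : E N → Measure (E N)) (C : ℝ) : Prop :=
  ∀ x ∈ Ω, (∫⁻ z in Metric.ball (0 : E N) 1, ENNReal.ofReal (‖z‖ ^ 2) ∂(μ x))
    + μ x (Metric.ball (0 : E N) 1)ᶜ ≤ ENNReal.ofReal C

/-- Condition (E): `F` is continuous on `Ω × [0,T] × ℝ^N × 𝕊^N × ℝ` and degenerate elliptic. -/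
structure CondE {N : ℕ} (Ω : Set (E N)) (T : ℝ) (F : Nonlinearity N) : Prop where
  continuousOn : ContinuousOn
    (fun q : E N × ℝ × E N × Mat N × ℝ => F q.1 q.2.1 q.2.2.1 q.2.2.2.1 q.2.2.2.2)
    {q | q.1 ∈ Ω ∧ q.2.1 ∈ Icc 0 T ∧ q.2.2.2.1.IsSymm}
  elliptic : ∀ x ∈ Ω, ∀ t ∈ Icc 0 T, ∀ p : E N, p ≠ 0 →
    ∀ X Y : Mat N, X.IsSymm → Y.IsSymm → (X - Y).PosSemidef →
    ∀ l₁ l₂ : ℝ, l₂ ≤ l₁ → F x t p X l₁ ≤ F x t p Y l₂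

/-- The double cone `C_{η,γ}(p) = {z : (1-η) |z| |p| ≤ |p · z| ≤ 1/γ}`. -/
def cone {N : ℕ} (η γ : ℝ) (p : E N) : Set (E N) :=
  {z | (1 - η) * ‖z‖ * ‖p‖ ≤ |inner ℝ p z| ∧ |inner ℝ p z| ≤ 1 / γ}

/-- Condition (N): `F(x, t, p, I - γ p ⊗ p, C - c γ ∫_{C_{η,γ}(p)} |p · z|² μ_x(dz)) → +∞` as
`γ → +∞`, uniformly in `|x - x̄| ≤ R`, `|t - t₀| ≤ R`, `R/2 ≤ |p| ≤ R`. -/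
def CondN {N : ℕ} (Ω : Set (E N)) (T : ℝ) (μ : E N → Measure (E N)) (C : ℝ)
    (F : Nonlinearity N) : Prop :=
  ∀ x₀ ∈ Ω, ∀ t₀ ∈ Ioo 0 T, ∃ R₀ > 0, ∃ η : ℝ, 0 ≤ η ∧ η < 1 ∧
    ∀ R : ℝ, 0 < R → R < R₀ → ∀ c : ℝ, 0 < c →
      ∀ K : ℝ, ∃ γ₁ > 0, ∀ γ ≥ γ₁,
        ∀ x ∈ Ω, ‖x - x₀‖ ≤ R → ∀ t ∈ Icc 0 T, |t - t₀| ≤ R →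
          ∀ p : E N, R / 2 ≤ ‖p‖ → ‖p‖ ≤ R →
            K ≤ F x t p (1 - γ • tensorSq p)
              (C - c * γ * ∫ z in cone η γ p, |inner ℝ p z| ^ 2 ∂(μ x))

/-- Condition (S): `F(x, t, ε p, ε (I - γ p ⊗ p), ε l) ≥ ε F(x, t, p, I - γ p ⊗ p, l)`, locally
around each point of `Ω × (0, T)`. -/
def CondS {N : ℕ} (Ω : Set (E N)) (T : ℝ) (F : Nonlinearity N) : Prop :=
  ∀ x₀ ∈ Ω, ∀ t₀ ∈ Ioo 0 T, ∃ R₀ > 0, ∃ ε₀ > 0, ∃ γ₀ > 0,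
    ∀ R : ℝ, 0 < R → R < R₀ → ∀ ε : ℝ, 0 < ε → ε < ε₀ → ∀ γ ≥ γ₀,
      ∀ x ∈ Ω, ‖x - x₀‖ ≤ R → ∀ t ∈ Icc 0 T, |t - t₀| ≤ R →
        ∀ p : E N, R / 2 ≤ ‖p‖ → ‖p‖ ≤ R → ∀ l : ℝ,
          ε * F x t p (1 - γ • tensorSq p) l
            ≤ F x t (ε • p) (ε • (1 - γ • tensorSq p)) (ε * l)

/-- Condition (N'): `λ + F(x₀, t₀, 0, I, C) > 0` for some `λ > 0`, at each point of `Q_T`. -/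
def CondN' {N : ℕ} (Ω : Set (E N)) (T : ℝ) (C : ℝ) (F : Nonlinearity N) : Prop :=
  ∀ x₀ ∈ Ω, ∀ t₀ ∈ Ioc 0 T, ∃ lam > 0, 0 < lam + F x₀ t₀ 0 1 C

/-- Condition (S'): `F(x, t, ε p, ε I, ε l) ≥ ε F(x, t, p, I, l)` for `(x, t)` close to `(x₀, t₀)`,
`p` small and `l ≤ C`, around each point `(x₀, t₀)` of `Q_T`. -/
def CondS' {N : ℕ} (Ω : Set (E N)) (T : ℝ) (C : ℝ) (F : Nonlinearity N) : Prop :=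
  ∀ x₀ ∈ Ω, ∀ t₀ ∈ Ioc 0 T, ∃ r₀ > 0, ∃ ε₀ > 0,
    ∀ ε : ℝ, 0 < ε → ε < ε₀ → ∀ r : ℝ, 0 < r → r < r₀ →
      ∀ x ∈ Ω, ∀ t ∈ Icc 0 T, ‖x - x₀‖ ^ 2 + (t - t₀) ^ 2 < r ^ 2 →
        ∀ p : E N, ‖p‖ ≤ r → ∀ l : ℝ, l ≤ C →
          ε * F x t p 1 l ≤ F x t (ε • p) (ε • (1 : Mat N)) (ε * l)

/-- The set `S(P₀)`: points of `Q_T` joined to `P₀` by a simple continuous curve in `Q_T` along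
which the time coordinate is nondecreasing from the point to `P₀` (and `P₀` itself). -/
def pastReachable {N : ℕ} (Ω : Set (E N)) (T : ℝ) (P₀ : E N × ℝ) : Set (E N × ℝ) :=
  {Q | Q = P₀ ∨ ∃ c : ℝ → E N × ℝ, ContinuousOn c (Icc 0 1) ∧ InjOn c (Icc 0 1) ∧
    MapsTo c (Icc 0 1) (cylinder Ω T) ∧ c 0 = Q ∧ c 1 = P₀ ∧
    MonotoneOn (fun s => (c s).2) (Icc 0 1)}

end

end NonlocalSMP

namespace NonlocalSMP

/-! The set where `u` equals its maximum `M` propagates in two ways. At a fixed time below `T` it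
spreads over whole connected components of `Ω` (`eq_max_of_isPreconnected`), by Hopf's argument.
Otherwise some ellipsoid in space-time, free of maximum points inside, touches the maximum set at a
point whose normal is not vertical. Subtracting a small multiple of an exponential barrier gives a
test function near that point, and (S) and (N) with a large exponent contradict the viscosity
inequality (`false_of_interior_ellipsoid`). Backwards in time, every maximum point is approached by
strictly earlier ones (`exists_earlier_max`). Otherwise a thin cap below the point carries a barrier
that contradicts (N') and (S').

Alternating the two, the least time in `[t, t₀]` at which `u (x₀, ·) = M` must be `t`, and spreading
at time `t` reaches the whole component of `x₀`. The curve is used only through the component and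
the ordering of times.

At each time both barriers are Gaussian profiles `c - k exp (-(κ/2)|y - a|²)`. Their gradient and
Hessian are `e p` and `e (I - κ p ⊗ p)` with `p = x - a` and one common factor `e`, the form that
(S) and (N) require. The nonlocal side is `nearIntegral_add_farIntegral_le`, where the convexity of
the exponential on the cone produces the negative term in (N). -/

/-- The function `y ↦ c - k exp (-(κ/2) |y - a|²)`. -/
noncomputable def gaussProfile {N : ℕ} (a : E N) (c k κ : ℝ) (y : E N) : ℝ :=
  c - k * Real.exp (-(κ / 2) * ‖y - a‖ ^ 2)

/-! ### Derivatives of Gaussian profiles. -/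

section Gauss

variable {N : ℕ} (a : E N) (c k κ : ℝ) (x : E N)

lemma hasFDerivAt_exp_normSq :
    HasFDerivAt (fun y : E N => Real.exp (-(κ / 2) * ‖y - a‖ ^ 2))
      ((-κ * Real.exp (-(κ / 2) * ‖x - a‖ ^ 2)) • innerSL ℝ (x - a)) x := by
  have h := (((hasFDerivAt_id x).sub_const a).norm_sq.const_mul (-(κ / 2))).exp
  refine h.congr_fderiv ?_
  ext v
  simp
  ring

lemma hasFDerivAt_gaussProfile :
    HasFDerivAt (gaussProfile a c k κ)
      ((k * κ * Real.exp (-(κ / 2) * ‖x - a‖ ^ 2)) • innerSL ℝ (x - a)) x := by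
  have h := ((hasFDerivAt_exp_normSq a κ x).const_mul k).const_sub c
  refine h.congr_fderiv ?_
  ext v
  simp
  ring

lemma gradient_gaussProfile :
    gradient (gaussProfile a c k κ) x
      = (k * κ * Real.exp (-(κ / 2) * ‖x - a‖ ^ 2)) • (x - a) := by
  apply HasGradientAt.gradient
  rw [hasGradientAt_iff_hasFDerivAt]
  refine (hasFDerivAt_gaussProfile a c k κ x).congr_fderiv ?_
  ext v
  simp

lemma hessian_gaussProfile :
    hessian (gaussProfile a c k κ) x
      = (k * κ * Real.exp (-(κ / 2) * ‖x - a‖ ^ 2)) • (1 - κ • tensorSq (x - a)) := by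
  have h1 : fderiv ℝ (gaussProfile a c k κ) = fun y =>
      (k * κ * Real.exp (-(κ / 2) * ‖y - a‖ ^ 2)) • innerSL ℝ (y - a) :=
    funext fun y => (hasFDerivAt_gaussProfile a c k κ y).fderiv
  let J : E N →L[ℝ] E N →L[ℝ] ℝ := innerSL ℝ
  have h2 : HasFDerivAt (fun y =>
      (k * κ * Real.exp (-(κ / 2) * ‖y - a‖ ^ 2)) • J (y - a))
      ((k * κ * Real.exp (-(κ / 2) * ‖x - a‖ ^ 2)) • J +
        ((k * κ) • (-κ * Real.exp (-(κ / 2) * ‖x - a‖ ^ 2)) • innerSL ℝ (x - a)).smulRight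
          (J (x - a))) x :=
    ((hasFDerivAt_exp_normSq a κ x).const_mul (k * κ)).smul
      (J.hasFDerivAt.comp x ((hasFDerivAt_id x).sub_const a))
  have hJ : ∀ v w : E N, J v w = inner ℝ v w := fun _ _ => rfl
  change fderiv ℝ (gaussProfile a c k κ) = fun y =>
      (k * κ * Real.exp (-(κ / 2) * ‖y - a‖ ^ 2)) • J (y - a) at h1
  ext i j
  rw [hessian, h1, Matrix.of_apply, h2.fderiv]
  simp only [add_apply, smul_apply, ContinuousLinearMap.smulRight_apply, hJ, innerSL_apply_apply]
  rcases eq_or_ne i j with hij | hij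
  · subst hij
    simp [tensorSq, Matrix.vecMulVec, EuclideanSpace.inner_single_right]
    ring
  · simp [tensorSq, Matrix.vecMulVec, EuclideanSpace.inner_single_right, hij]
    ring

end Gauss

/-! ### Integrability against a Lévy measure. -/

section Levy

variable {N : ℕ} {ν : Measure (E N)} {C : ℝ}

/-- The weight `min 1 |z|²` combines both halves of (M) and dominates every increment below. -/
lemma lintegral_min_one_normSq_le
    (hν : (∫⁻ z in Metric.ball (0 : E N) 1, ENNReal.ofReal (‖z‖ ^ 2) ∂ν)
      + ν (Metric.ball (0 : E N) 1)ᶜ ≤ ENNReal.ofReal C) :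
    ∫⁻ z, ENNReal.ofReal (min 1 (‖z‖ ^ 2)) ∂ν ≤ ENNReal.ofReal C := by
  rw [← lintegral_add_compl _ (measurableSet_ball : MeasurableSet (Metric.ball (0 : E N) 1))]
  refine le_trans (add_le_add ?_ ?_) hν
  · exact lintegral_mono fun z => ENNReal.ofReal_le_ofReal (min_le_right _ _)
  · refine (lintegral_mono (g := fun _ => 1) fun z => ?_).trans (by simp)
    exact ENNReal.ofReal_le_one.2 (min_le_left _ _)

lemma integrable_min_one_normSq
    (h : ∫⁻ z, ENNReal.ofReal (min 1 (‖z‖ ^ 2)) ∂ν ≤ ENNReal.ofReal C) :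
    Integrable (fun z : E N => min 1 (‖z‖ ^ 2)) ν := by
  refine ⟨(by fun_prop : Continuous fun z : E N => min 1 (‖z‖ ^ 2)).aestronglyMeasurable, ?_⟩
  rw [hasFiniteIntegral_iff_ofReal (ae_of_all _ fun z => by positivity)]
  exact h.trans_lt ENNReal.ofReal_lt_top

lemma integral_min_one_normSq_le (hC : 0 ≤ C)
    (h : ∫⁻ z, ENNReal.ofReal (min 1 (‖z‖ ^ 2)) ∂ν ≤ ENNReal.ofReal C) :
    ∫ z, min 1 (‖z‖ ^ 2) ∂ν ≤ C := by
  rw [integral_eq_lintegral_of_nonneg_ae (ae_of_all _ fun z => by positivity)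
    (integrable_min_one_normSq h).1]
  exact ENNReal.toReal_le_of_le_ofReal hC h

lemma measurable_increment {w : E N → ℝ} (hw : Measurable w) (x p : E N) :
    Measurable (increment w x p) := by
  have h : Measurable (compensator p) :=
    (by fun_prop : Continuous fun z : E N => (inner ℝ p z : ℝ)).measurable.indicator
      measurableSet_ball
  exact ((hw.comp (measurable_const_add x)).sub_const _).sub h

end Levy

/-! ### Elementary exponential inequalities. -/

lemma one_sub_exp_neg_le (s : ℝ) : 1 - Real.exp (-s) ≤ s := by
  linarith [Real.add_one_le_exp (-s)]

/-- Square `exp (-s/2) ≥ 1 - s/2`; the bound `s ≤ 2` keeps the right side nonnegative. -/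
lemma one_sub_exp_neg_le_sub_sq {s : ℝ} (hs : s ≤ 2) : 1 - Real.exp (-s) ≤ s - s ^ 2 / 4 := by
  have h1 := Real.add_one_le_exp (-(s / 2))
  have h2 : Real.exp (-s) = Real.exp (-(s / 2)) ^ 2 := by
    rw [← Real.exp_nat_mul]; congr 1; push_cast; ring
  nlinarith [Real.exp_pos (-(s / 2))]

lemma abs_one_sub_exp_neg_sub_le {s K : ℝ} (hs : |s| ≤ K) :
    |1 - Real.exp (-s) - s| ≤ Real.exp K * s ^ 2 := by
  have h := Real.add_one_le_exp (-s)
  have h2 := Real.add_one_le_exp s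
  have h3 : Real.exp (-s) ≤ Real.exp K := Real.exp_le_exp.2 ((neg_le_abs s).trans hs)
  have h4 : 1 ≤ Real.exp K := Real.one_le_exp ((abs_nonneg s).trans hs)
  have h5 : Real.exp (-s) * Real.exp s = 1 := by rw [← Real.exp_add]; simp
  have h6 := Real.exp_pos (-s)
  rw [abs_le]
  constructor
  · rcases le_or_gt 0 s with h0 | h0
    · have : Real.exp (-s) - 1 + s ≤ s ^ 2 := by
        by_cases h7 : s ≤ 1
        · have := Real.abs_exp_sub_one_sub_id_le (x := -s) (by rw [abs_neg, abs_of_nonneg h0]; exact h7)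
          have := (abs_le.1 this).2
          nlinarith
        · have : Real.exp (-s) ≤ 1 := by simpa using h0
          nlinarith
      nlinarith [sq_nonneg s]
    · have : Real.exp (-s) - 1 ≤ -s * Real.exp (-s) := by nlinarith
      have : Real.exp (-s) - 1 + s ≤ s ^ 2 * Real.exp (-s) := by nlinarith
      nlinarith [sq_nonneg s]
  · nlinarith [sq_nonneg s, Real.exp_pos K]

/-! ### Nonlocal term of a Gaussian profile. -/

section Profile

variable {N : ℕ} (a x z : E N) (c k κ : ℝ)

lemma gaussProfile_add_sub :
    gaussProfile a c k κ (x + z) - gaussProfile a c k κ x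
      = k * Real.exp (-(κ / 2) * ‖x - a‖ ^ 2)
        * (1 - Real.exp (-(κ * inner ℝ (x - a) z + κ / 2 * ‖z‖ ^ 2))) := by
  have h1 : ‖x + z - a‖ ^ 2 = ‖x - a‖ ^ 2 + 2 * inner ℝ (x - a) z + ‖z‖ ^ 2 := by
    rw [← norm_add_sq_real]; congr 2; abel
  have h2 : Real.exp (-(κ / 2) * ‖x + z - a‖ ^ 2) = Real.exp (-(κ / 2) * ‖x - a‖ ^ 2)
      * Real.exp (-(κ * inner ℝ (x - a) z + κ / 2 * ‖z‖ ^ 2)) := by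
    rw [← Real.exp_add, h1]; congr 1; ring
  simp only [gaussProfile]
  rw [h2]; ring

variable {a x z c k κ}

/-- In the ball, `1 - exp (-s) ≤ s` and the compensator cancels the linear part of `s`. Outside it,
the increment is at most the amplitude, and `κ ≥ 1` supplies the extra factor. -/
lemma increment_gaussProfile_le (hk : 0 ≤ k) (hκ : 1 ≤ κ) :
    increment (gaussProfile a c k κ) x (gradient (gaussProfile a c k κ) x) z
      ≤ k * κ * Real.exp (-(κ / 2) * ‖x - a‖ ^ 2) * min 1 (‖z‖ ^ 2) := by
  rw [increment, gaussProfile_add_sub, gradient_gaussProfile, compensator]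
  set e := Real.exp (-(κ / 2) * ‖x - a‖ ^ 2)
  have he : 0 ≤ k * e := by positivity
  by_cases hz : z ∈ Metric.ball (0 : E N) 1
  · rw [indicator_of_mem hz, inner_smul_left]
    rw [mem_ball_zero_iff] at hz
    have h2 : ‖z‖ ^ 2 ≤ 1 := by nlinarith [norm_nonneg z]
    rw [min_eq_right h2]
    simp only [conj_trivial]
    have := mul_le_mul_of_nonneg_left
      (one_sub_exp_neg_le (κ * inner ℝ (x - a) z + κ / 2 * ‖z‖ ^ 2)) he
    nlinarith [mul_nonneg he (mul_nonneg (by linarith : 0 ≤ κ) (sq_nonneg ‖z‖))]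
  · rw [indicator_of_notMem hz]
    rw [mem_ball_zero_iff, not_lt] at hz
    have h2 : 1 ≤ ‖z‖ ^ 2 := by nlinarith [norm_nonneg z]
    rw [min_eq_left h2]
    nlinarith [mul_nonneg he (Real.exp_pos (-(κ * inner ℝ (x - a) z + κ / 2 * ‖z‖ ^ 2))).le,
      mul_nonneg he (by linarith : 0 ≤ κ - 1)]

/-- The second-order gain `-s²/4` is at most `-(κ p·z)²/16` by `hs'`. Factoring out one `κ` leaves
the term of (N) with `c = 1/16`. -/
lemma increment_gaussProfile_le_of_le_two (hk : 0 ≤ k) (hκ : 1 ≤ κ) (hz : ‖z‖ < 1)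
    (hs : κ * inner ℝ (x - a) z + κ / 2 * ‖z‖ ^ 2 ≤ 2)
    (hs' : (κ * inner ℝ (x - a) z) ^ 2 / 4 ≤ (κ * inner ℝ (x - a) z + κ / 2 * ‖z‖ ^ 2) ^ 2) :
    increment (gaussProfile a c k κ) x (gradient (gaussProfile a c k κ) x) z
      ≤ k * κ * Real.exp (-(κ / 2) * ‖x - a‖ ^ 2)
        * (min 1 (‖z‖ ^ 2) - κ / 16 * |inner ℝ (x - a) z| ^ 2) := by
  rw [increment, gaussProfile_add_sub, gradient_gaussProfile, compensator]
  set e := Real.exp (-(κ / 2) * ‖x - a‖ ^ 2)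
  have he : 0 ≤ k * e := by positivity
  rw [indicator_of_mem (by simpa using hz), inner_smul_left, sq_abs]
  have h2 : ‖z‖ ^ 2 ≤ 1 := by nlinarith [norm_nonneg z]
  rw [min_eq_right h2]
  simp only [conj_trivial]
  have h3 : 1 - Real.exp (-(κ * inner ℝ (x - a) z + κ / 2 * ‖z‖ ^ 2)) ≤
      κ * inner ℝ (x - a) z + κ * ‖z‖ ^ 2 - (κ * inner ℝ (x - a) z) ^ 2 / 16 := by
    have := one_sub_exp_neg_le_sub_sq hs
    nlinarith [mul_nonneg (by linarith : 0 ≤ κ) (sq_nonneg ‖z‖)]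
  have := mul_le_mul_of_nonneg_left h3 he
  calc _ ≤ _ := sub_le_sub_right this _
    _ = _ := by ring

/-- A crude two-sided bound; its only role is the integrability of the near part. -/
lemma abs_increment_gaussProfile_le (hk : 0 ≤ k) (hκ : 1 ≤ κ) (hz : ‖z‖ < 1) :
    |increment (gaussProfile a c k κ) x (gradient (gaussProfile a c k κ) x) z|
      ≤ k * (Real.exp (κ * ‖x - a‖ + κ) * (κ * ‖x - a‖ + κ) ^ 2 + κ) * min 1 (‖z‖ ^ 2) := by
  rw [increment, gaussProfile_add_sub, gradient_gaussProfile, compensator]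
  set e := Real.exp (-(κ / 2) * ‖x - a‖ ^ 2) with hedef
  have he0 : 0 ≤ e := (Real.exp_pos _).le
  have he1 : e ≤ 1 := Real.exp_le_one_iff.2 (by nlinarith [sq_nonneg ‖x - a‖])
  rw [indicator_of_mem (by simpa using hz), inner_smul_left]
  have hn := norm_nonneg z
  have hκ0 : 0 ≤ κ := by linarith
  have h2 : ‖z‖ ^ 2 ≤ 1 := by nlinarith [norm_nonneg z]
  rw [min_eq_right h2]
  simp only [conj_trivial]
  set i : ℝ := inner ℝ (x - a) z
  have hi : |i| ≤ ‖x - a‖ * ‖z‖ := abs_real_inner_le_norm _ _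
  have hs : |κ * i + κ / 2 * ‖z‖ ^ 2| ≤ (κ * ‖x - a‖ + κ) * ‖z‖ := by
    refine (abs_add_le _ _).trans ?_
    rw [abs_mul, abs_of_nonneg hκ0, abs_of_nonneg (by positivity : 0 ≤ κ / 2 * ‖z‖ ^ 2)]
    have : κ * |i| ≤ κ * (‖x - a‖ * ‖z‖) := by gcongr
    have : κ / 2 * ‖z‖ ^ 2 ≤ κ * ‖z‖ := by
      have : ‖z‖ ^ 2 ≤ ‖z‖ := by nlinarith
      nlinarith
    nlinarith
  have hL : 0 ≤ κ * ‖x - a‖ + κ := by positivity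
  have hs1 := abs_one_sub_exp_neg_sub_le (hs.trans (mul_le_of_le_one_right hL hz.le))
  have hs2 : (κ * i + κ / 2 * ‖z‖ ^ 2) ^ 2 ≤ (κ * ‖x - a‖ + κ) ^ 2 * ‖z‖ ^ 2 := by
    rw [← sq_abs, ← mul_pow]
    gcongr
  have heq : k * e * (1 - Real.exp (-(κ * i + κ / 2 * ‖z‖ ^ 2))) - k * κ * e * i
      = k * e * ((1 - Real.exp (-(κ * i + κ / 2 * ‖z‖ ^ 2)) - (κ * i + κ / 2 * ‖z‖ ^ 2))
        + κ / 2 * ‖z‖ ^ 2) := by ring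
  rw [heq, abs_mul, abs_of_nonneg (by positivity : 0 ≤ k * e), mul_assoc k _ (‖z‖ ^ 2)]
  have h6 := abs_add_le (1 - Real.exp (-(κ * i + κ / 2 * ‖z‖ ^ 2)) - (κ * i + κ / 2 * ‖z‖ ^ 2))
    (κ / 2 * ‖z‖ ^ 2)
  rw [abs_of_nonneg (by positivity : 0 ≤ κ / 2 * ‖z‖ ^ 2)] at h6
  refine mul_le_mul (mul_le_of_le_one_right hk he1) (h6.trans ?_) (abs_nonneg _) hk
  have := mul_le_mul_of_nonneg_left hs2 (Real.exp_pos (κ * ‖x - a‖ + κ)).le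
  nlinarith [mul_nonneg (by linarith : 0 ≤ κ) (sq_nonneg ‖z‖)]

/-- Upper bound for the split nonlocal term of a function touched from above by a Gaussian
profile. -/
lemma nearIntegral_add_farIntegral_le {ν : Measure (E N)} {C δ : ℝ} (hC : 0 ≤ C)
    (hν : ∫⁻ z, ENNReal.ofReal (min 1 (‖z‖ ^ 2)) ∂ν ≤ ENNReal.ofReal C)
    (hδ : δ < 1) (hk : 0 ≤ k) (hκ : 1 ≤ κ) {A : Set (E N)} (hA : MeasurableSet A)
    (hA1 : ∀ z ∈ A, ‖z‖ < 1)
    (hA2 : ∀ z ∈ A, κ * inner ℝ (x - a) z + κ / 2 * ‖z‖ ^ 2 ≤ 2)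
    (hA3 : ∀ z ∈ A, (κ * inner ℝ (x - a) z) ^ 2 / 4
      ≤ (κ * inner ℝ (x - a) z + κ / 2 * ‖z‖ ^ 2) ^ 2)
    {u : E N → ℝ}
    (hu : ∀ y, u y - u x ≤ gaussProfile a c k κ y - gaussProfile a c k κ x)
    (hint : IntegrableOn (increment u x (gradient (gaussProfile a c k κ) x))
      {z : E N | δ < ‖z‖} ν) :
    nearIntegral ν δ (gaussProfile a c k κ) x
        + farIntegral ν δ (gradient (gaussProfile a c k κ) x) u x
      ≤ k * κ * Real.exp (-(κ / 2) * ‖x - a‖ ^ 2)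
        * (C - 1 / 16 * κ * ∫ z in A, |inner ℝ (x - a) z| ^ 2 ∂ν) := by
  set ε := k * κ * Real.exp (-(κ / 2) * ‖x - a‖ ^ 2) with hε
  have hε0 : 0 ≤ ε := by positivity
  have hW := integrable_min_one_normSq hν
  have hWC := integral_min_one_normSq_le hC hν
  have hInn : Integrable (A.indicator fun z : E N => |inner ℝ (x - a) z| ^ 2) ν := by
    refine (hW.const_mul (‖x - a‖ ^ 2)).mono' ?_ (ae_of_all _ fun z => ?_)
    · exact ((by fun_prop : Continuous fun z : E N => |(inner ℝ (x - a) z : ℝ)| ^ 2).measurable.indicator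
        hA).aestronglyMeasurable
    · by_cases hz : z ∈ A
      · have := hA1 z hz
        rw [indicator_of_mem hz, Real.norm_of_nonneg (by positivity),
          min_eq_right (by nlinarith [norm_nonneg z]), ← mul_pow]
        gcongr
        exact abs_real_inner_le_norm _ _
      · rw [indicator_of_notMem hz]
        simp only [norm_zero]
        positivity
  -- One majorant for both the near and the far integrand, so that the split integrals recombine.
  set h : E N → ℝ := fun z =>
    ε * (min 1 (‖z‖ ^ 2) - κ / 16 * A.indicator (fun z : E N => |inner ℝ (x - a) z| ^ 2) z) with hh
  have hhint : Integrable h ν := (hW.sub (hInn.const_mul _)).const_mul _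
  have hle : ∀ z, increment (gaussProfile a c k κ) x (gradient (gaussProfile a c k κ) x) z
      ≤ h z := by
    intro z
    by_cases hz : z ∈ A
    · have := increment_gaussProfile_le_of_le_two (c := c) hk hκ (hA1 z hz) (hA2 z hz) (hA3 z hz)
      simpa only [hh, indicator_of_mem hz] using this
    · have := increment_gaussProfile_le (a := a) (c := c) (x := x) (z := z) hk hκ
      simpa only [hh, indicator_of_notMem hz, mul_zero, sub_zero] using this
  have hle' : ∀ z, increment u x (gradient (gaussProfile a c k κ) x) z ≤ h z := fun z =>
    le_trans (sub_le_sub_right (hu (x + z)) _) (hle z)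
  have hmN : MeasurableSet {z : E N | ‖z‖ ≤ δ} := measurableSet_le measurable_norm measurable_const
  have hmF : MeasurableSet {z : E N | δ < ‖z‖} := measurableSet_lt measurable_const measurable_norm
  have hcompl : {z : E N | ‖z‖ ≤ δ}ᶜ = {z : E N | δ < ‖z‖} := by ext z; simp
  -- Integrability is needed for monotonicity, since a divergent Bochner integral is 0 by
  -- convention. For the far part it comes from the subsolution property.
  have hnear : IntegrableOn (increment (gaussProfile a c k κ) x
      (gradient (gaussProfile a c k κ) x)) {z : E N | ‖z‖ ≤ δ} ν := by
    refine (hW.const_mul (k * (Real.exp (κ * ‖x - a‖ + κ) * (κ * ‖x - a‖ + κ) ^ 2 + κ))).integrableOn.mono'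
      (measurable_increment ?_ _ _).aestronglyMeasurable ?_
    · exact (by unfold gaussProfile; fun_prop : Continuous (gaussProfile a c k κ)).measurable
    · refine (ae_restrict_iff' hmN).2 (ae_of_all _ fun z hz => ?_)
      exact abs_increment_gaussProfile_le hk hκ (lt_of_le_of_lt hz hδ)
  have hI1 : nearIntegral ν δ (gaussProfile a c k κ) x ≤ ∫ z in {z : E N | ‖z‖ ≤ δ}, h z ∂ν :=
    setIntegral_mono hnear hhint.integrableOn hle
  have hI2 : farIntegral ν δ (gradient (gaussProfile a c k κ) x) u x
      ≤ ∫ z in {z : E N | δ < ‖z‖}, h z ∂ν :=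
    setIntegral_mono hint hhint.integrableOn hle'
  have hsum := integral_add_compl hmN hhint
  rw [hcompl] at hsum
  have hval : ∫ z, h z ∂ν = ε * (∫ z, min 1 (‖z‖ ^ 2) ∂ν
      - κ / 16 * ∫ z in A, |inner ℝ (x - a) z| ^ 2 ∂ν) := by
    simp only [hh]
    rw [integral_const_mul, integral_sub hW (hInn.const_mul _), integral_const_mul,
      integral_indicator hA]
  calc _ ≤ ∫ z, h z ∂ν := by rw [← hsum]; exact add_le_add hI1 hI2
    _ ≤ _ := by
      rw [hval]
      refine mul_le_mul_of_nonneg_left ?_ hε0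
      linarith

end Profile

/-! ### Localising maxima of perturbations. -/

open Topology Filter in
/-- Perturbing an upper semicontinuous function with maximum at `P` by a small multiple of a
function whose nonpositivity set meets the maximum set at `P` only gives maxima close to `P`. -/
lemma exists_isMaxOn_sub_mul {X : Type*} [TopologicalSpace X] {S : Set X} {u v : X → ℝ}
    (hu : UpperSemicontinuousOn u S) (hv : Continuous v) {P : X} (hP : P ∈ S)
    (hmax : ∀ Q ∈ S, u Q ≤ u P) (hvP : v P = 0) (hK : IsCompact (S ∩ {Q | v Q ≤ 0}))
    (huniq : ∀ Q ∈ S, v Q ≤ 0 → u Q = u P → Q = P) {U : Set X} (hU : U ∈ 𝓝 P) :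
    ∃ ε₁ > 0, ∀ ε : ℝ, 0 < ε → ε < ε₁ →
      ∃ Q ∈ S ∩ U, ∀ Q' ∈ S, u Q' - ε * v Q' ≤ u Q - ε * v Q := by
  have hPK : P ∈ S ∩ {Q | v Q ≤ 0} := ⟨hP, hvP.le⟩
  obtain ⟨m, hm⟩ : ∃ m, ∀ Q ∈ S ∩ {Q | v Q ≤ 0}, -m ≤ v Q := by
    obtain ⟨Q, -, hQ⟩ := hK.exists_isMinOn ⟨P, hPK⟩ hv.continuousOn
    exact ⟨-v Q, fun Q' hQ' => by simpa using hQ hQ'⟩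
  have hm0 : 0 ≤ m := by have := hm P hPK; linarith
  -- Removing the interior of `U` leaves a compact set, so the strict inequality becomes a gap `d`.
  obtain ⟨d, hd, hdle⟩ : ∃ d > 0, ∀ Q ∈ (S ∩ {Q | v Q ≤ 0}) \ interior U, u Q ≤ u P - d := by
    rcases ((S ∩ {Q | v Q ≤ 0}) \ interior U).eq_empty_or_nonempty with he | hne
    · exact ⟨1, one_pos, by simp [he]⟩
    · obtain ⟨Q, hQ, hQmax⟩ := UpperSemicontinuousOn.exists_isMaxOn hne
        (hK.diff isOpen_interior) (hu.mono fun Q hQ => hQ.1.1)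
      refine ⟨u P - u Q, ?_, fun Q' hQ' => by simpa using hQmax hQ'⟩
      rcases (hmax Q hQ.1.1).lt_or_eq with h | h
      · linarith
      · have := huniq Q hQ.1.1 hQ.1.2 h
        exact absurd (mem_interior_iff_mem_nhds.2 hU) (this ▸ hQ.2)
  -- The perturbation gains at most `ε m`, which must stay below `d`; the `+ 1` covers `m = 0`.
  refine ⟨d / (m + 1), by positivity, fun ε hε hε1 => ?_⟩
  have hus : UpperSemicontinuousOn (fun Q => u Q - ε * v Q) (S ∩ {Q | v Q ≤ 0}) := by
    have h2 : ContinuousOn (fun Q => -(ε * v Q)) (S ∩ {Q | v Q ≤ 0}) := by fun_prop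
    simpa only [sub_eq_add_neg] using
      (hu.mono inter_subset_left).add h2.upperSemicontinuousOn
  obtain ⟨Q, hQ, hQmax⟩ := UpperSemicontinuousOn.exists_isMaxOn ⟨P, hPK⟩ hK hus
  have hQP : u P ≤ u Q - ε * v Q := by
    have := hQmax hPK
    simpa [hvP] using this
  refine ⟨Q, ⟨hQ.1, ?_⟩, fun Q' hQ' => ?_⟩
  · by_contra hQU
    have h1 := hdle Q ⟨hQ, fun h => hQU (interior_subset h)⟩
    have h2 := hm Q hQ
    rw [lt_div_iff₀ (by linarith)] at hε1
    nlinarith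
  · by_cases h : v Q' ≤ 0
    · exact hQmax ⟨hQ', h⟩
    · have := hmax Q' hQ'
      push Not at h
      nlinarith [mul_pos hε h]

/-! ### Size of the phase on the cone of (N). -/

section Cone

variable {N : ℕ}

lemma measurableSet_cone (η γ : ℝ) (p : E N) : MeasurableSet (cone η γ p) := by
  have h : Continuous fun z : E N => |(inner ℝ p z : ℝ)| := by fun_prop
  have h' : Continuous fun z : E N => (1 - η) * ‖z‖ * ‖p‖ := by fun_prop
  exact ((isClosed_le h' h).inter (isClosed_le h continuous_const)).measurableSet

lemma norm_lt_one_of_mem_cone {η κ q : ℝ} {p z : E N} (hqp : q ≤ (1 - η) * ‖p‖)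
    (hκ : 0 < κ) (hκ1 : 1 < κ * q) (hz : z ∈ cone η κ p) : ‖z‖ < 1 := by
  have h1 : q * ‖z‖ ≤ 1 / κ := by
    refine le_trans ?_ (hz.1.trans hz.2)
    nlinarith [norm_nonneg z]
  rw [le_div_iff₀ hκ] at h1
  by_contra h
  push Not at h
  nlinarith [mul_pos hκ hκ]

/-- On the cone `q |z| ≤ |p·z| ≤ 1/κ`. Hence `|z| ≤ 1/(κ q) ≤ q` and `|z|² ≤ |p·z|`: the quadratic
part of the phase is at most half the linear part. -/
lemma abs_sub_le_of_mem_cone {η κ q : ℝ} {p z : E N} (hq : 0 < q) (hqp : q ≤ (1 - η) * ‖p‖)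
    (hκ : 0 < κ) (hκ2 : 1 ≤ κ * q ^ 2) (hz : z ∈ cone η κ p) :
    κ / 2 * ‖z‖ ^ 2 ≤ κ * |inner ℝ p z| / 2 := by
  have h0 : q * ‖z‖ ≤ |inner ℝ p z| := by
    refine le_trans ?_ hz.1
    nlinarith [norm_nonneg z]
  have h1 : κ * (q * ‖z‖) ≤ 1 := by
    have := h0.trans hz.2
    rw [le_div_iff₀ hκ] at this
    linarith
  have h2 : ‖z‖ ≤ q := by
    have : (κ * q) * ‖z‖ ≤ (κ * q) * q := by nlinarith
    exact le_of_mul_le_mul_left this (by positivity)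
  have h3 : ‖z‖ ^ 2 ≤ |inner ℝ p z| := by nlinarith [norm_nonneg z]
  nlinarith

lemma phase_le_two_of_mem_cone {η κ q : ℝ} {p z : E N} (hq : 0 < q) (hqp : q ≤ (1 - η) * ‖p‖)
    (hκ : 0 < κ) (hκ2 : 1 ≤ κ * q ^ 2) (hz : z ∈ cone η κ p) :
    κ * inner ℝ p z + κ / 2 * ‖z‖ ^ 2 ≤ 2 := by
  have h1 := abs_sub_le_of_mem_cone hq hqp hκ hκ2 hz
  have h2 := hz.2
  rw [le_div_iff₀ hκ] at h2
  nlinarith [le_abs_self (inner ℝ p z : ℝ)]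

lemma sq_le_sq_phase_of_mem_cone {η κ q : ℝ} {p z : E N} (hq : 0 < q)
    (hqp : q ≤ (1 - η) * ‖p‖) (hκ : 0 < κ) (hκ2 : 1 ≤ κ * q ^ 2) (hz : z ∈ cone η κ p) :
    (κ * inner ℝ p z) ^ 2 / 4 ≤ (κ * inner ℝ p z + κ / 2 * ‖z‖ ^ 2) ^ 2 := by
  have h1 := abs_sub_le_of_mem_cone hq hqp hκ hκ2 hz
  have h3 : 0 ≤ κ / 2 * ‖z‖ ^ 2 := by positivity
  set w := κ / 2 * ‖z‖ ^ 2
  rcases le_or_gt 0 (inner ℝ p z : ℝ) with h | h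
  · rw [abs_of_nonneg h] at h1
    nlinarith [mul_nonneg hκ.le h]
  · rw [abs_of_neg h] at h1
    nlinarith [mul_pos hκ (neg_pos.2 h)]

end Cone

/-! ### The viscosity inequality with Gaussian test functions. -/

section Test

variable {N : ℕ} {Ω : Set (E N)} {T C δ : ℝ} {μ : E N → Measure (E N)} {F : Nonlinearity N}
  {u : E N × ℝ → ℝ}

lemma isSymm_one_sub_smul_tensorSq (κ : ℝ) (p : E N) : (1 - κ • tensorSq p).IsSymm := by
  refine Matrix.IsSymm.sub Matrix.isSymm_one (Matrix.IsSymm.smul ?_ _)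
  ext i j
  simp [tensorSq, Matrix.vecMulVec, mul_comm]

/-- The viscosity inequality for a test function which is a Gaussian profile in space. -/
lemma IsSubsolutionAt.exists_le_of_gaussProfile {x : E N} {t : ℝ}
    (hu : IsSubsolutionAt F μ T δ u x t) (hM : CondM Ω μ C) (hx : x ∈ Ω) (ht : t ∈ Icc 0 T)
    (hC : 0 ≤ C) (hδ : δ < 1) {φ : E N × ℝ → ℝ} (hφ : ContDiff ℝ 2 φ)
    (hmax : ∀ y : E N, ∀ s ∈ Icc 0 T, u (y, s) - φ (y, s) ≤ u (x, t) - φ (x, t))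
    {a : E N} {c k κ : ℝ} (hφt : (fun y => φ (y, t)) = gaussProfile a c k κ)
    (hk : 0 ≤ k) (hκ : 1 ≤ κ) {A : Set (E N)} (hA : MeasurableSet A)
    (hA1 : ∀ z ∈ A, ‖z‖ < 1)
    (hA2 : ∀ z ∈ A, κ * inner ℝ (x - a) z + κ / 2 * ‖z‖ ^ 2 ≤ 2)
    (hA3 : ∀ z ∈ A, (κ * inner ℝ (x - a) z) ^ 2 / 4
      ≤ (κ * inner ℝ (x - a) z + κ / 2 * ‖z‖ ^ 2) ^ 2) :
    ∃ l ≤ k * κ * Real.exp (-(κ / 2) * ‖x - a‖ ^ 2)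
        * (C - 1 / 16 * κ * ∫ z in A, |inner ℝ (x - a) z| ^ 2 ∂(μ x)),
      deriv (fun s => φ (x, s)) t
        + F x t ((k * κ * Real.exp (-(κ / 2) * ‖x - a‖ ^ 2)) • (x - a))
          ((k * κ * Real.exp (-(κ / 2) * ‖x - a‖ ^ 2)) • (1 - κ • tensorSq (x - a))) l ≤ 0 := by
  obtain ⟨h1, h2⟩ := hu φ hφ hmax
  rw [hφt] at h1 h2
  refine ⟨_, nearIntegral_add_farIntegral_le hC (lintegral_min_one_normSq_le (hM x hx)) hδ hk hκ
    hA hA1 hA2 hA3 (u := fun y => u (y, t)) (fun y => ?_) h1, ?_⟩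
  · rw [← hφt]
    have := hmax y t ht
    simp only
    linarith
  · rw [← gradient_gaussProfile a c, ← hessian_gaussProfile a c]
    exact h2

end Test

/-! ### Geometry of ellipsoids in space-time. -/

section Ellipsoid

variable {N : ℕ}

/-- An ellipsoid shrunk towards a boundary point touches the original one only there. -/
lemma eq_of_mem_shrunk_ellipsoid {a x y : E N} {b t τ lam s : ℝ} (hlam : 0 < lam) (hs : 0 < s)
    (hs1 : s < 1)
    (h1 : ‖x - a‖ ^ 2 + lam * (t - b) ^ 2 ≤ ‖y - a‖ ^ 2 + lam * (τ - b) ^ 2)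
    (h2 : ‖y - (x - s • (x - a))‖ ^ 2 + lam * (τ - (t - s * (t - b))) ^ 2
      ≤ ‖s • (x - a)‖ ^ 2 + lam * (s * (t - b)) ^ 2) : y = x ∧ τ = t := by
  have e1 : ‖y - a‖ ^ 2 = ‖y - x‖ ^ 2 + 2 * inner ℝ (y - x) (x - a) + ‖x - a‖ ^ 2 := by
    rw [← norm_add_sq_real]; congr 2; abel
  have e2 : ‖y - (x - s • (x - a))‖ ^ 2
      = ‖y - x‖ ^ 2 + 2 * (s * inner ℝ (y - x) (x - a)) + ‖s • (x - a)‖ ^ 2 := by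
    rw [← real_inner_smul_right, ← norm_add_sq_real]; congr 2; abel
  rw [e1] at h1
  rw [e2] at h2
  set i : ℝ := inner ℝ (y - x) (x - a)
  have h3 : ‖y - x‖ ^ 2 + lam * (τ - t) ^ 2 + 2 * s * (i + lam * (τ - t) * (t - b)) ≤ 0 := by
    nlinarith
  have h4 : 0 ≤ ‖y - x‖ ^ 2 + lam * (τ - t) ^ 2 + 2 * (i + lam * (τ - t) * (t - b)) := by
    nlinarith
  -- Subtract `s` times `h4` from `h3`: the cross terms cancel.
  have h5 : (1 - s) * (‖y - x‖ ^ 2 + lam * (τ - t) ^ 2) ≤ 0 := by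
    nlinarith [mul_nonneg hs.le h4]
  have h6 : ‖y - x‖ ^ 2 + lam * (τ - t) ^ 2 ≤ 0 := nonpos_of_mul_nonpos_right h5 (by linarith)
  have h7 : 0 ≤ lam * (τ - t) ^ 2 := by positivity
  have h8 : ‖y - x‖ ^ 2 = 0 := le_antisymm (by linarith) (by positivity)
  have h9 : lam * (τ - t) ^ 2 = 0 := le_antisymm (by nlinarith [sq_nonneg ‖y - x‖]) h7
  constructor
  · exact sub_eq_zero.1 (norm_eq_zero.1 (pow_eq_zero_iff two_ne_zero |>.1 h8))
  · have := (mul_eq_zero.1 h9).resolve_left hlam.ne'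
    exact sub_eq_zero.1 (pow_eq_zero_iff two_ne_zero |>.1 this)

lemma isCompact_ellipsoid (a : E N) (b ρ : ℝ) {lam : ℝ} (hlam : 0 < lam) :
    IsCompact {Q : E N × ℝ | ‖Q.1 - a‖ ^ 2 + lam * (Q.2 - b) ^ 2 ≤ ρ} := by
  set r := 1 + |ρ| + |ρ| / lam
  have hr : 0 ≤ |ρ| / lam := by positivity
  have hρ := le_abs_self ρ
  have hρ0 := abs_nonneg ρ
  refine ((isCompact_closedBall a r).prod (isCompact_closedBall b r)).of_isClosed_subset
    (isClosed_le (by fun_prop) (by fun_prop)) fun Q hQ => ?_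
  simp only [mem_ofPred_eq] at hQ
  have hn : 0 ≤ lam * (Q.2 - b) ^ 2 := by positivity
  have hn' := sq_nonneg ‖Q.1 - a‖
  have hr1 : r ≤ r ^ 2 := by nlinarith
  refine ⟨?_, ?_⟩
  · rw [mem_closedBall_iff_norm]
    refine abs_le_of_sq_le_sq' ?_ (by positivity) |>.2
    linarith
  · rw [mem_closedBall_iff_norm, Real.norm_eq_abs]
    refine abs_le_of_sq_le_sq ?_ (by positivity)
    have : (Q.2 - b) ^ 2 ≤ |ρ| / lam := by
      rw [le_div_iff₀ hlam]; linarith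
    linarith

end Ellipsoid

/-! ### The exponential barrier of an ellipsoid. -/

section Barrier

variable {N : ℕ} (a : E N) (b lam ρ κ : ℝ)

/-- The barrier which is negative inside the ellipsoid `|y - a|² + lam (s - b)² ≤ ρ`. -/
noncomputable def ellipsoidBarrier (Q : E N × ℝ) : ℝ :=
  Real.exp (-(κ / 2) * ρ) - Real.exp (-(κ / 2) * (‖Q.1 - a‖ ^ 2 + lam * (Q.2 - b) ^ 2))

lemma contDiff_ellipsoidBarrier : ContDiff ℝ 2 (ellipsoidBarrier a b lam ρ κ) := by
  have h1 : ContDiff ℝ 2 fun Q : E N × ℝ => ‖Q.1 - a‖ ^ 2 :=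
    (contDiff_fst.sub contDiff_const).norm_sq ℝ
  unfold ellipsoidBarrier
  fun_prop

lemma ellipsoidBarrier_nonpos_iff {a : E N} {b lam ρ κ : ℝ} (hκ : 0 < κ) (Q : E N × ℝ) :
    ellipsoidBarrier a b lam ρ κ Q ≤ 0 ↔ ‖Q.1 - a‖ ^ 2 + lam * (Q.2 - b) ^ 2 ≤ ρ := by
  rw [ellipsoidBarrier, sub_nonpos, Real.exp_le_exp]
  constructor <;> intro h <;> nlinarith

lemma mul_ellipsoidBarrier_eq_gaussProfile (ε τ : ℝ) :
    (fun y => ε * ellipsoidBarrier a b lam ρ κ (y, τ))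
      = gaussProfile a (ε * Real.exp (-(κ / 2) * ρ))
        (ε * Real.exp (-(κ / 2) * (lam * (τ - b) ^ 2))) κ := by
  funext y
  rw [ellipsoidBarrier, gaussProfile, mul_add, Real.exp_add]
  ring

/-- The right side displays the same factor `e` that multiplies the gradient and the Hessian, so
that `e` divides out of the viscosity inequality. -/
lemma deriv_mul_ellipsoidBarrier (ε : ℝ) (y : E N) (τ : ℝ) :
    deriv (fun s => ε * ellipsoidBarrier a b lam ρ κ (y, s)) τ
      = ε * Real.exp (-(κ / 2) * (lam * (τ - b) ^ 2)) * κ * Real.exp (-(κ / 2) * ‖y - a‖ ^ 2)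
        * (lam * (τ - b)) := by
  have h1 : HasDerivAt (fun s : ℝ => -(κ / 2) * (‖y - a‖ ^ 2 + lam * (s - b) ^ 2))
      (-(κ / 2) * (lam * (2 * (τ - b)))) τ := by
    have h0 := ((((((hasDerivAt_id τ).sub_const b).pow 2).const_mul lam).const_add
      (‖y - a‖ ^ 2)).const_mul (-(κ / 2)))
    simpa using h0
  have h2 := (h1.exp.const_sub (Real.exp (-(κ / 2) * ρ))).const_mul ε
  refine h2.deriv.trans ?_
  rw [mul_add, Real.exp_add]
  ring

end Barrier

/-! ### Hopf's argument at a non-vertical normal. -/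

section Touching

variable {N : ℕ} {Ω : Set (E N)} {T C δ : ℝ} {μ : E N → Measure (E N)} {F : Nonlinearity N}
  {u : E N × ℝ → ℝ}

/-- The set where a subsolution attains its maximum is not touched from inside its complement by
an ellipsoid at a point where the normal is not vertical. -/
lemma false_of_interior_ellipsoid (hΩ : IsOpen Ω) (hC : 0 ≤ C) (hM : CondM Ω μ C)
    (hE : CondE Ω T F) (hS : CondS Ω T F) (hNd : CondN Ω T μ C F) (hδ : δ < 1)
    (hu : IsViscositySubsolution F μ Ω T δ u) {x : E N} {t : ℝ} (hx : x ∈ Ω) (ht : t ∈ Ioo 0 T)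
    (hmax : ∀ y : E N, ∀ s ∈ Icc 0 T, u (y, s) ≤ u (x, t))
    {a : E N} {b lam : ℝ} (hlam : 0 < lam) (ha : x ≠ a)
    (hint : ∀ y : E N, ∀ s ∈ Icc 0 T,
      ‖y - a‖ ^ 2 + lam * (s - b) ^ 2 < ‖x - a‖ ^ 2 + lam * (t - b) ^ 2 → u (y, s) < u (x, t)) :
    False := by
  obtain ⟨R₁, hR₁, η, hη0, hη1, HN⟩ := hNd x hx t ht
  obtain ⟨R₂, hR₂, ε₀, hε₀, γ₀, hγ₀, HS⟩ := hS x hx t ht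
  have hxa : 0 < ‖x - a‖ := norm_pos_iff.2 (sub_ne_zero.2 ha)
  obtain ⟨s, hs, hs1, hsR⟩ : ∃ s > 0, s < 1 ∧ 4 / 3 * (s * ‖x - a‖) < min R₁ R₂ := by
    have hR : 0 < min R₁ R₂ := lt_min hR₁ hR₂
    refine ⟨min (1 / 2) (min R₁ R₂ / (2 * ‖x - a‖)), by positivity,
      (min_le_left _ _).trans_lt (by norm_num), ?_⟩
    have := min_le_right (1 / 2) (min R₁ R₂ / (2 * ‖x - a‖))
    rw [le_div_iff₀ (by positivity)] at this
    linarith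
  obtain ⟨d, hd⟩ : ∃ d, d = s * ‖x - a‖ := ⟨_, rfl⟩
  rw [← hd] at hsR
  have hd0 : 0 < d := by rw [hd]; exact mul_pos hs hxa
  obtain ⟨a', ha'⟩ : ∃ a', a' = x - s • (x - a) := ⟨_, rfl⟩
  obtain ⟨b', hb'⟩ : ∃ b', b' = t - s * (t - b) := ⟨_, rfl⟩
  have hxa' : x - a' = s • (x - a) := by rw [ha']; abel
  have htb' : t - b' = s * (t - b) := by rw [hb']; ring
  have hnxa' : ‖x - a'‖ = d := by rw [hxa', norm_smul, Real.norm_of_nonneg hs.le, hd]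
  obtain ⟨ρ, hρ⟩ : ∃ ρ, ρ = ‖x - a'‖ ^ 2 + lam * (t - b') ^ 2 := ⟨_, rfl⟩
  -- For `|y - x| < d/3` and `|x - a'| = d`, the norm `|y - a'|` lies in `[2d/3, 4d/3] = [R/2, R]`,
  -- the annulus of (S) and (N).
  obtain ⟨R, hR⟩ : ∃ R, R = 4 / 3 * d := ⟨_, rfl⟩
  rw [← hR] at hsR
  have hR0 : 0 < R := by linarith
  -- `K` outweighs the time derivative, which near `x, t` is at least `-lam (|t - b'| + d)` up to
  -- the factor `e`.
  obtain ⟨K, hK⟩ : ∃ K, K = lam * (|t - b'| + d) + 1 := ⟨_, rfl⟩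
  obtain ⟨γ₁, hγ₁, HN⟩ := HN R hR0 (hsR.trans_le (min_le_left _ _)) (1 / 16) (by norm_num) K
  obtain ⟨q, hq⟩ : ∃ q, q = (1 - η) * (R / 2) := ⟨_, rfl⟩
  have hq0 : 0 < q := hq ▸ mul_pos (by linarith) (by linarith)
  -- In `CondS` the parameter `γ` ranges over natural numbers, so the exponent is chosen integral
  -- and then cast to `κ`.
  obtain ⟨n, hnγ₁, hκγ₀, hκ1, hκq, hκq2⟩ : ∃ n : ℕ, γ₁ ≤ n ∧ γ₀ ≤ n ∧ 1 ≤ (n : ℝ) ∧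
      1 < n * q ∧ 1 ≤ n * q ^ 2 := by
    obtain ⟨n₁, h₁⟩ := exists_nat_ge γ₁
    obtain ⟨n₂, h₂⟩ := exists_nat_gt (1 / q)
    obtain ⟨n₃, h₃⟩ := exists_nat_ge (1 / q ^ 2)
    rw [div_lt_iff₀ hq0] at h₂
    rw [div_le_iff₀ (by positivity)] at h₃
    refine ⟨n₁ + n₂ + n₃ + γ₀ + 1, h₁.trans (by norm_cast; omega), by omega,
      by norm_cast; omega, h₂.trans_le (mul_le_mul_of_nonneg_right (by norm_cast; omega) hq0.le),
      h₃.trans (mul_le_mul_of_nonneg_right (by norm_cast; omega) (by positivity))⟩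
  obtain ⟨κ, hκn⟩ : ∃ κ : ℝ, κ = n := ⟨_, rfl⟩
  have hκγ₁ : γ₁ ≤ κ := hnγ₁.trans_eq hκn.symm
  rw [← hκn] at hκ1 hκq hκq2
  have hκ0 : 0 < κ := by linarith
  obtain ⟨v, hv⟩ : ∃ v, v = ellipsoidBarrier a' b' lam ρ κ := ⟨_, rfl⟩
  have hvC : ContDiff ℝ 2 v := hv ▸ contDiff_ellipsoidBarrier a' b' lam ρ κ
  have hvle : ∀ Q : E N × ℝ, v Q ≤ 0 ↔ ‖Q.1 - a'‖ ^ 2 + lam * (Q.2 - b') ^ 2 ≤ ρ :=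
    fun Q => hv ▸ ellipsoidBarrier_nonpos_iff hκ0 Q
  have hcl : IsClosed ((univ : Set (E N)) ×ˢ Icc (0 : ℝ) T) := isClosed_univ.prod isClosed_Icc
  have htI : t ∈ Icc 0 T := Ioo_subset_Icc_self ht
  obtain ⟨ε₁, hε₁, Hmax⟩ := exists_isMaxOn_sub_mul (P := (x, t))
    (U := (Ω ∩ Metric.ball x (d / 3)) ×ˢ (Ioo 0 T ∩ Metric.ball t (d / 3)))
    hu.usc hvC.continuous (mk_mem_prod (mem_univ _) htI) (fun Q hQ => hmax Q.1 Q.2 hQ.2)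
    (by simp [hv, hρ, ellipsoidBarrier])
    (by
      refine IsCompact.of_isClosed_subset (isCompact_ellipsoid a' b' ρ hlam)
        (hcl.inter (isClosed_le hvC.continuous continuous_const)) ?_
      exact fun Q hQ => (hvle Q).1 hQ.2)
    (by
      rintro ⟨y, τ⟩ hQ hvQ huQ
      have h1 : ‖x - a‖ ^ 2 + lam * (t - b) ^ 2 ≤ ‖y - a‖ ^ 2 + lam * (τ - b) ^ 2 := by
        by_contra h
        exact absurd huQ (hint y τ hQ.2 (not_le.1 h)).ne
      have h2 := (hvle (y, τ)).1 hvQ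
      rw [hρ, hxa', htb', ha', hb'] at h2
      exact Prod.ext_iff.2 (eq_of_mem_shrunk_ellipsoid hlam hs hs1 h1 h2))
    (prod_mem_nhds
      (Filter.inter_mem (hΩ.mem_nhds hx) (Metric.ball_mem_nhds _ (by positivity)))
      (Filter.inter_mem (isOpen_Ioo.mem_nhds ht) (Metric.ball_mem_nhds _ (by positivity))))
  obtain ⟨ε, hε, hεε₁, hεε₀⟩ : ∃ ε > 0, ε < ε₁ ∧ ε * κ < ε₀ := by
    refine ⟨min (ε₁ / 2) (ε₀ / (2 * κ)), by positivity,
      (min_le_left _ _).trans_lt (by linarith), ?_⟩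
    have := min_le_right (ε₁ / 2) (ε₀ / (2 * κ))
    rw [le_div_iff₀ (by positivity)] at this
    linarith
  obtain ⟨⟨y, τ⟩, ⟨hS1, ⟨hyΩ, hyx⟩, hτI, hτt⟩, hQmax⟩ := Hmax ε hε hεε₁
  simp only at hyΩ hyx hτI hτt
  rw [mem_ball_iff_norm] at hyx hτt
  rw [Real.norm_eq_abs] at hτt
  have hτC : τ ∈ Icc 0 T := Ioo_subset_Icc_self hτI
  obtain ⟨p, hp⟩ : ∃ p, p = y - a' := ⟨_, rfl⟩
  have hpd : p = (y - x) + (x - a') := by rw [hp]; abel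
  have hpR : ‖p‖ ≤ R := by
    rw [hpd]
    refine (norm_add_le _ _).trans ?_
    rw [hnxa']
    linarith
  have hpR' : R / 2 ≤ ‖p‖ := by
    have : ‖x - a'‖ ≤ ‖p‖ + ‖y - x‖ := by
      rw [show x - a' = p - (y - x) by rw [hpd]; abel]
      exact norm_sub_le _ _
    linarith
  have hqp : q ≤ (1 - η) * ‖p‖ := hq ▸ mul_le_mul_of_nonneg_left hpR' (by linarith)
  obtain ⟨k, hk⟩ : ∃ k, k = ε * Real.exp (-(κ / 2) * (lam * (τ - b') ^ 2)) := ⟨_, rfl⟩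
  have hk0 : 0 < k := hk ▸ mul_pos hε (Real.exp_pos _)
  have hφC : ContDiff ℝ 2 fun Q => ε * v Q := contDiff_const.mul hvC
  have hφmax : ∀ y' : E N, ∀ s' ∈ Icc 0 T,
      u (y', s') - (fun Q => ε * v Q) (y', s') ≤ u (y, τ) - (fun Q => ε * v Q) (y, τ) :=
    fun y' s' hs' => hQmax (y', s') ⟨mem_univ _, hs'⟩
  have hφeq : (fun y => (fun Q => ε * v Q) (y, τ))
      = gaussProfile a' (ε * Real.exp (-(κ / 2) * ρ)) k κ := by
    rw [hv, hk]; exact mul_ellipsoidBarrier_eq_gaussProfile a' b' lam ρ κ ε τ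
  have hA1 : ∀ z ∈ cone η κ p, ‖z‖ < 1 := fun z => norm_lt_one_of_mem_cone hqp hκ0 hκq
  have hA2 : ∀ z ∈ cone η κ p, κ * inner ℝ (y - a') z + κ / 2 * ‖z‖ ^ 2 ≤ 2 := by
    rw [← hp]
    exact fun z => phase_le_two_of_mem_cone hq0 hqp hκ0 hκq2
  have hA3 : ∀ z ∈ cone η κ p, (κ * inner ℝ (y - a') z) ^ 2 / 4
      ≤ (κ * inner ℝ (y - a') z + κ / 2 * ‖z‖ ^ 2) ^ 2 := by
    rw [← hp]
    exact fun z => sq_le_sq_phase_of_mem_cone hq0 hqp hκ0 hκq2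
  obtain ⟨l, hl, hineq⟩ := (hu.subsolutionAt y hyΩ τ hτI).exists_le_of_gaussProfile hM hyΩ hτC hC
    hδ hφC hφmax hφeq hk0.le hκ1 (measurableSet_cone η κ p) hA1 hA2 hA3
  rw [← hp] at hl hineq
  obtain ⟨e, he⟩ : ∃ e, e = k * κ * Real.exp (-(κ / 2) * ‖p‖ ^ 2) := ⟨_, rfl⟩
  rw [← he] at hl hineq
  have he0 : 0 < e := by rw [he]; positivity
  have heε : e < ε₀ := by
    refine lt_of_le_of_lt ?_ hεε₀
    rw [he]
    have hκn0 : -(κ / 2) ≤ 0 := by linarith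
    have h1 : Real.exp (-(κ / 2) * ‖p‖ ^ 2) ≤ 1 :=
      Real.exp_le_one_iff.2 (mul_nonpos_of_nonpos_of_nonneg hκn0 (by positivity))
    have h2 : k ≤ ε := by
      rw [hk]
      exact mul_le_of_le_one_right hε.le
       (Real.exp_le_one_iff.2 (mul_nonpos_of_nonpos_of_nonneg hκn0 (by positivity)))
    have h3 : k * κ ≤ ε * κ := mul_le_mul_of_nonneg_right h2 hκ0.le
    exact (mul_le_of_le_one_right (by positivity) h1).trans h3
  have hderiv : deriv (fun s => ε * v (y, s)) τ = e * (lam * (τ - b')) := by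
    rw [hv, deriv_mul_ellipsoidBarrier, he, hk, hp]
  rw [hderiv] at hineq
  have hpx : ‖y - x‖ ≤ R := by linarith
  have hpt : |τ - t| ≤ R := by linarith
  have hNK := HN κ hκγ₁ y hyΩ hpx τ hτC hpt p hpR' hpR
  have hSK := HS R hR0 (hsR.trans_le (min_le_right _ _)) e he0 heε n hκγ₀ y hyΩ hpx τ hτC hpt p
    hpR' hpR (C - 1 / 16 * κ * ∫ z in cone η κ p, |inner ℝ p z| ^ 2 ∂(μ y))
  rw [← Nat.cast_smul_eq_nsmul ℝ n (tensorSq p), ← hκn] at hSK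
  have hp0 : p ≠ 0 := norm_pos_iff.1 (by linarith)
  have hsym : (e • (1 - κ • tensorSq p)).IsSymm := (isSymm_one_sub_smul_tensorSq κ p).smul e
  -- Only monotonicity in the nonlocal argument is used: the two matrices coincide.
  have hEl := hE.elliptic y hyΩ τ hτC (e • p) (smul_ne_zero he0.ne' hp0) _ _ hsym hsym
    (by rw [sub_self]; exact Matrix.PosSemidef.zero) _ _ hl
  have hKe : e * K ≤ e * _ := mul_le_mul_of_nonneg_left hNK he0.le
  have hfin : e * (lam * (τ - b') + K) ≤ 0 := by
    rw [mul_add]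
    linarith
  have hpos : 0 < lam * (τ - b') + K := by
    have h1 : -(|t - b'| + d) ≤ τ - b' := by
      have h2 := neg_abs_le (t - b')
      have h3 := neg_abs_le (τ - t)
      linarith
    have := mul_le_mul_of_nonneg_left h1 hlam.le
    rw [hK]
    linarith
  exact absurd hfin (not_le.2 (mul_pos he0 hpos))

end Touching

/-! ### Propagation at a fixed time. -/

section Horizontal

variable {N : ℕ} {Ω : Set (E N)} {T C δ M : ℝ} {μ : E N → Measure (E N)} {F : Nonlinearity N}
  {u : E N × ℝ → ℝ}

/-- If `u (x, t) < M`, take an ellipsoid centred at `(x, t)` through `(y, t)`, so short in time that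
`u < M` on its axis. The maximum point in it with least ellipsoidal distance is off the axis and is
touched by an ellipsoid free of maximum points inside. -/
lemma eq_max_center_of_mem_closedBall (hΩ : IsOpen Ω) (hC : 0 ≤ C) (hM : CondM Ω μ C)
    (hE : CondE Ω T F) (hS : CondS Ω T F) (hNd : CondN Ω T μ C F) (hδ : δ < 1)
    (hu : IsViscositySubsolution F μ Ω T δ u) {t : ℝ} (ht : t ∈ Ioo 0 T)
    (hmax : ∀ y : E N, ∀ s ∈ Icc 0 T, u (y, s) ≤ M) {x y : E N} {d : ℝ}
    (hd : Metric.closedBall x d ⊆ Ω) (hy : y ∈ Metric.closedBall x d) (huy : u (y, t) = M) :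
    u (x, t) = M := by
  have htI : t ∈ Icc 0 T := Ioo_subset_Icc_self ht
  by_contra hne
  have hlt : u (x, t) < M := lt_of_le_of_ne (hmax x t htI) hne
  have hyx : 0 < ‖y - x‖ := norm_pos_iff.2 (sub_ne_zero.2 fun h => hne (h ▸ huy))
  obtain ⟨r, hr, hrt, hru⟩ : ∃ r > 0, (∀ s, |s - t| < r → s ∈ Ioo 0 T) ∧
      ∀ s, |s - t| < r → u (x, s) < M := by
    have h1 := hu.usc (x, t) ⟨mem_univ _, htI⟩ M hlt
    rw [eventually_nhdsWithin_iff] at h1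
    have h2 : ∀ᶠ s in nhds t, (x, s) ∈ univ ×ˢ Icc 0 T → u (x, s) < M :=
      ((Continuous.prodMk_right x).tendsto t).eventually h1
    obtain ⟨r, hr, h⟩ := Metric.eventually_nhds_iff.1 (h2.and (isOpen_Ioo.mem_nhds ht))
    exact ⟨r, hr, fun s hs => (h hs).2,
      fun s hs => (h hs).1 ⟨mem_univ _, Ioo_subset_Icc_self (h hs).2⟩⟩
  -- This makes the time half-width of the ellipsoid equal to `r/2`.
  set lam := (2 * ‖y - x‖ / r) ^ 2 with hlam
  have hlam0 : 0 < lam := by positivity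
  have hclose : ∀ s, lam * (s - t) ^ 2 ≤ ‖y - x‖ ^ 2 → |s - t| < r := by
    intro s hs
    have h1 : (2 * ‖y - x‖ / r * |s - t|) ^ 2 ≤ ‖y - x‖ ^ 2 := by rwa [mul_pow, sq_abs]
    have h2 := (pow_le_pow_iff_left₀ (by positivity) (by positivity) two_ne_zero).1 h1
    rw [div_mul_eq_mul_div, div_le_iff₀ hr] at h2
    have h3 : 2 * |s - t| ≤ r := le_of_mul_le_mul_left (by linarith) hyx
    have := abs_nonneg (s - t)
    linarith
  have hcomp : IsCompact ({Q : E N × ℝ | ‖Q.1 - x‖ ^ 2 + lam * (Q.2 - t) ^ 2 ≤ ‖y - x‖ ^ 2}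
      ∩ u ⁻¹' Ici M) := by
    refine UpperSemicontinuousOn.isCompact_inter_preimage_Ici
      ?_ (isCompact_ellipsoid x t (‖y - x‖ ^ 2) hlam0) M
    refine hu.usc.mono fun Q hQ => ⟨mem_univ _, Ioo_subset_Icc_self (hrt _ (hclose _ ?_))⟩
    have := sq_nonneg ‖Q.1 - x‖
    have hQ' : ‖Q.1 - x‖ ^ 2 + lam * (Q.2 - t) ^ 2 ≤ ‖y - x‖ ^ 2 := hQ
    linarith
  have hcont : Continuous fun Q : E N × ℝ => ‖Q.1 - x‖ ^ 2 + lam * (Q.2 - t) ^ 2 := by fun_prop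
  obtain ⟨⟨z, τ⟩, ⟨hz, hzM⟩, hmin⟩ :=
    hcomp.exists_isMinOn ⟨(y, t), by simp, huy.ge⟩ hcont.continuousOn
  have hz' : ‖z - x‖ ^ 2 + lam * (τ - t) ^ 2 ≤ ‖y - x‖ ^ 2 := hz
  have hτr : |τ - t| < r := hclose τ (by have := sq_nonneg ‖z - x‖; linarith)
  have hτ := hrt τ hτr
  have hzM' : u (z, τ) = M := le_antisymm (hmax z τ (Ioo_subset_Icc_self hτ)) hzM
  have hzx : z ≠ x := by
    rintro rfl
    exact (hru τ hτr).ne hzM'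
  have hzΩ : z ∈ Ω := by
    refine hd ?_
    rw [mem_closedBall_iff_norm] at hy ⊢
    refine le_trans ?_ hy
    refine (pow_le_pow_iff_left₀ (by positivity) (by positivity) two_ne_zero).1 ?_
    have : 0 ≤ lam * (τ - t) ^ 2 := by positivity
    linarith
  refine false_of_interior_ellipsoid hΩ hC hM hE hS hNd hδ hu hzΩ hτ
    (fun y' s hs => (hmax y' s hs).trans_eq hzM'.symm) (b := t) hlam0 hzx fun y' s hs hlt' => ?_
  rw [hzM']
  refine lt_of_le_of_ne (hmax y' s hs) fun h => ?_
  have := hmin (a := (y', s)) ⟨hlt'.le.trans hz', h.ge⟩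
  exact absurd hlt' (not_lt.2 this)

/-- On small balls the maximum is attained everywhere or nowhere, so the maximum set is open and
relatively closed. -/
lemma eq_max_of_isPreconnected (hΩ : IsOpen Ω) (hC : 0 ≤ C) (hM : CondM Ω μ C)
    (hE : CondE Ω T F) (hS : CondS Ω T F) (hNd : CondN Ω T μ C F) (hδ : δ < 1)
    (hu : IsViscositySubsolution F μ Ω T δ u) {t : ℝ} (ht : t ∈ Ioo 0 T)
    (hmax : ∀ y : E N, ∀ s ∈ Icc 0 T, u (y, s) ≤ M) {Z : Set (E N)} (hZ : IsPreconnected Z)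
    (hZΩ : Z ⊆ Ω) {x : E N} (hx : x ∈ Z) (hux : u (x, t) = M) :
    ∀ y ∈ Z, u (y, t) = M := by
  have key : ∀ y ∈ Ω, ∃ r > 0, Metric.ball y r ⊆ Ω ∧ ∀ z ∈ Metric.ball y r,
      ∀ w ∈ Metric.ball y r, u (w, t) = M → u (z, t) = M := by
    intro y hy
    obtain ⟨r, hr, hrΩ⟩ := Metric.isOpen_iff.1 hΩ y hy
    refine ⟨r / 4, by positivity, (Metric.ball_subset_ball (by linarith)).trans hrΩ,
      fun z hz w hw huw => ?_⟩
    rw [Metric.mem_ball] at hz hw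
    refine eq_max_center_of_mem_closedBall hΩ hC hM hE hS hNd hδ hu ht hmax (y := w) (d := r / 2)
      (fun v hv => hrΩ ?_) ?_ huw
    · rw [Metric.mem_closedBall] at hv
      rw [Metric.mem_ball]
      linarith [dist_triangle v z y]
    · rw [Metric.mem_closedBall]
      linarith [dist_triangle_right w z y]
  have hopen : IsOpen {y | y ∈ Ω ∧ u (y, t) = M} := by
    rw [Metric.isOpen_iff]
    rintro y ⟨hy, huy⟩
    obtain ⟨r, hr, hrΩ, h⟩ := key y hy
    exact ⟨r, hr, fun z hz => ⟨hrΩ hz, h z hz y (Metric.mem_ball_self hr) huy⟩⟩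
  have hsub := hZ.subset_of_closure_inter_subset hopen ⟨x, hx, hZΩ hx, hux⟩ (by
    rintro y ⟨hy, hyZ⟩
    obtain ⟨r, hr, -, h⟩ := key y (hZΩ hyZ)
    obtain ⟨w, ⟨-, huw⟩, hw⟩ := Metric.mem_closure_iff.1 hy r hr
    exact ⟨hZΩ hyZ, h y (Metric.mem_ball_self hr) w (by rwa [Metric.mem_ball']) huw⟩)
  exact fun y hy => (hsub hy).2

end Horizontal

/-! ### Propagation backwards in time. -/

section Vertical

variable {N : ℕ} {Ω : Set (E N)} {T C δ M : ℝ} {μ : E N → Measure (E N)} {F : Nonlinearity N}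
  {u : E N × ℝ → ℝ}

/-- Degenerate ellipticity extends by continuity to vanishing gradients. -/
lemma CondE.le_of_posSemidef [NeZero N] (hE : CondE Ω T F) {x : E N} (hx : x ∈ Ω) {t : ℝ}
    (ht : t ∈ Icc 0 T) (p : E N) {X Y : Mat N} (hX : X.IsSymm) (hY : Y.IsSymm)
    (hXY : (X - Y).PosSemidef) {l₁ l₂ : ℝ} (hl : l₂ ≤ l₁) : F x t p X l₁ ≤ F x t p Y l₂ := by
  by_cases hp : p = 0
  · subst hp
    obtain ⟨v, hv⟩ := exists_ne (0 : E N)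
    have hcont : ∀ (Z : Mat N), Z.IsSymm → ∀ l : ℝ,
        Filter.Tendsto (fun s : ℝ => F x t (s • v) Z l) (nhdsWithin 0 (Ioi 0))
          (nhds (F x t 0 Z l)) := by
      intro Z hZ l
      have h1 : Continuous fun s : ℝ => F x t (s • v) Z l :=
        hE.continuousOn.comp_continuous
          (f := fun s : ℝ => ((x, t, s • v, Z, l) : E N × ℝ × E N × Mat N × ℝ))
          (by fun_prop) (fun s => ⟨hx, ht, hZ⟩)
      have h2 := h1.tendsto 0
      rw [zero_smul] at h2
      exact h2.mono_left nhdsWithin_le_nhds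
    refine le_of_tendsto_of_tendsto (hcont X hX l₁) (hcont Y hY l₂) ?_
    filter_upwards [self_mem_nhdsWithin] with s hs
    exact hE.elliptic x hx t ht _ (smul_ne_zero (ne_of_gt hs) hv) X Y hX hY hXY l₁ l₂ hl
  · exact hE.elliptic x hx t ht p hp X Y hX hY hXY l₁ l₂ hl

lemma posSemidef_tensorSq (p : E N) : (tensorSq p).PosSemidef := by
  simpa [tensorSq] using Matrix.posSemidef_vecMulVec_self_star p.ofLp

/-- The barrier which is negative inside the cap `1 - exp (-|y - a|²/2) < -lam (s-b) - A (s-b)²`. -/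
noncomputable def capBarrier (a : E N) (b lam A : ℝ) (Q : E N × ℝ) : ℝ :=
  1 - Real.exp (-(1 / 2) * ‖Q.1 - a‖ ^ 2) + (lam * (Q.2 - b) + A * (Q.2 - b) ^ 2)

section Cap

variable (a : E N) (b lam A : ℝ)

lemma contDiff_capBarrier : ContDiff ℝ 2 (capBarrier a b lam A) := by
  have h1 : ContDiff ℝ 2 fun Q : E N × ℝ => ‖Q.1 - a‖ ^ 2 :=
    (contDiff_fst.sub contDiff_const).norm_sq ℝ
  unfold capBarrier
  fun_prop

lemma mul_capBarrier_eq_gaussProfile (ε τ : ℝ) :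
    (fun y => ε * capBarrier a b lam A (y, τ))
      = gaussProfile a (ε * (1 + (lam * (τ - b) + A * (τ - b) ^ 2))) ε 1 := by
  funext y
  rw [capBarrier, gaussProfile]
  ring

lemma deriv_mul_capBarrier (ε : ℝ) (y : E N) (τ : ℝ) :
    deriv (fun s => ε * capBarrier a b lam A (y, s)) τ = ε * (lam + 2 * A * (τ - b)) := by
  have h1 : HasDerivAt (fun s : ℝ => lam * (s - b) + A * (s - b) ^ 2)
      (lam + A * (2 * (τ - b))) τ := by
    have h2 := (hasDerivAt_id τ).sub_const b
    exact ((h2.const_mul lam).add ((h2.pow 2).const_mul A)).congr_deriv (by simp)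
  refine ((h1.const_add (1 - Real.exp (-(1 / 2) * ‖y - a‖ ^ 2))).const_mul ε).deriv.trans ?_
  ring

end Cap

/-- A maximum point of a subsolution has earlier maximum points in each of its neighbourhoods. -/
lemma exists_earlier_max [NeZero N] (hΩ : IsOpen Ω) (hC : 0 ≤ C) (hM : CondM Ω μ C)
    (hE : CondE Ω T F) (hS' : CondS' Ω T C F) (hNd' : CondN' Ω T C F) (hδ : δ < 1)
    (husc : UpperSemicontinuousOn u (univ ×ˢ Icc 0 T)) {x₀ : E N} (hx₀ : x₀ ∈ Ω) {t₀ : ℝ}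
    (ht₀ : t₀ ∈ Ioc 0 T)
    (hsub : ∀ x ∈ Ω, ∀ t ∈ Ioc 0 T, (t = T → t₀ = T) → IsSubsolutionAt F μ T δ u x t)
    (hmax : ∀ y : E N, ∀ s ∈ Icc 0 T, u (y, s) ≤ u (x₀, t₀)) {r : ℝ} (hr : 0 < r) :
    ∃ x t, ‖x - x₀‖ < r ∧ t₀ - r < t ∧ t < t₀ ∧ u (x, t) = u (x₀, t₀) := by
  by_contra! hno
  obtain ⟨lam, hlam, hlamF⟩ := hNd' x₀ hx₀ t₀ ht₀
  obtain ⟨r₀, hr₀, ε₀, hε₀, HS⟩ := hS' x₀ hx₀ t₀ ht₀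
  have ht₀I : t₀ ∈ Icc 0 T := Ioc_subset_Icc_self ht₀
  have hexp : 0 < 1 - Real.exp (-(1 / 2) * r ^ 2) := by
    rw [sub_pos, Real.exp_lt_one_iff]
    have : 0 < r ^ 2 := by positivity
    linarith
  -- Where the barrier is nonpositive, `s - t₀ ≥ -lam/A` and, completing the square, `1 - exp (-|y -
  -- x₀|²/2) ≤ lam²/(4A)`. A large `A` confines the cap to the given neighbourhood.
  obtain ⟨A, hA, hAr, hAe⟩ : ∃ A > 0, lam < A * r ∧
      lam ^ 2 < A * (1 - Real.exp (-(1 / 2) * r ^ 2)) := by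
    obtain ⟨w, hw⟩ : ∃ w, w = 1 - Real.exp (-(1 / 2) * r ^ 2) := ⟨_, rfl⟩
    rw [← hw] at hexp ⊢
    refine ⟨2 * lam / r + 2 * lam ^ 2 / w, by positivity, ?_, ?_⟩
    · have h1 : 2 * lam / r * r = 2 * lam := by field_simp
      have h2 : 0 < 2 * lam ^ 2 / w * r := by positivity
      linarith
    · have h1 : 2 * lam ^ 2 / w * w = 2 * lam ^ 2 := by field_simp
      have h2 : 0 < 2 * lam / r * w := by positivity
      have h3 : 0 < lam ^ 2 := by positivity
      linarith
  have hvneg : ∀ Q : E N × ℝ, capBarrier x₀ t₀ lam A Q ≤ 0 →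
      ‖Q.1 - x₀‖ < r ∧ t₀ - r < Q.2 ∧ Q.2 ≤ t₀ := by
    rintro ⟨y, τ⟩ hQ
    simp only [capBarrier] at hQ ⊢
    set θ := τ - t₀ with hθ
    have h1 : Real.exp (-(1 / 2) * ‖y - x₀‖ ^ 2) ≤ 1 := by
      rw [Real.exp_le_one_iff]
      have := sq_nonneg ‖y - x₀‖
      linarith
    have h2 : θ * (lam + A * θ) ≤ 0 := by linarith
    refine ⟨?_, ?_, ?_⟩
    · by_contra! h
      have h3 : Real.exp (-(1 / 2) * ‖y - x₀‖ ^ 2) ≤ Real.exp (-(1 / 2) * r ^ 2) := by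
        rw [Real.exp_le_exp]
        have : r ^ 2 ≤ ‖y - x₀‖ ^ 2 := by gcongr
        linarith
      have h4 : A * (lam * θ + A * θ ^ 2) ≤ A * -(1 - Real.exp (-(1 / 2) * r ^ 2)) :=
        mul_le_mul_of_nonneg_left (by linarith) hA.le
      have h5 : -lam ^ 2 ≤ A * (lam * θ + A * θ ^ 2) := by
        have h6 := sq_nonneg (2 * (A * θ) + lam)
        have h7 := sq_nonneg lam
        have h8 : A * (lam * θ + A * θ ^ 2) = ((2 * (A * θ) + lam) ^ 2 - lam ^ 2) / 4 := by ring
        linarith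
      linarith
    · by_contra! h
      have h3 : θ ≤ -r := by linarith
      have h4 : θ < 0 := by linarith
      have h5 : lam + A * θ < 0 := by
        have := mul_le_mul_of_nonneg_left h3 hA.le
        linarith
      exact absurd h2 (not_le.2 (mul_pos_of_neg_of_neg h4 h5))
    · by_contra! h
      have h3 : 0 < θ := by linarith
      exact absurd h2 (not_le.2 (by positivity))
  have hvC := contDiff_capBarrier x₀ t₀ lam A
  have hcl : IsClosed ((univ : Set (E N)) ×ˢ Icc (0 : ℝ) T) := isClosed_univ.prod isClosed_Icc
  have hG : ∀ᶠ Q in nhds (x₀, t₀), Q ∈ Ω ×ˢ Icc 0 T →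
      0 < lam + 2 * A * (Q.2 - t₀) + F Q.1 Q.2 (Q.1 - x₀) 1 C := by
    rw [← eventually_nhdsWithin_iff]
    have h1 : ContinuousOn (fun Q : E N × ℝ => F Q.1 Q.2 (Q.1 - x₀) 1 C) (Ω ×ˢ Icc 0 T) :=
      hE.continuousOn.comp
        (f := fun Q : E N × ℝ => ((Q.1, Q.2, Q.1 - x₀, 1, C) : E N × ℝ × E N × Mat N × ℝ))
        (by fun_prop) (fun Q hQ => ⟨hQ.1, hQ.2, Matrix.isSymm_one⟩)
    have h2 : ContinuousOn (fun Q : E N × ℝ =>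
        lam + 2 * A * (Q.2 - t₀) + F Q.1 Q.2 (Q.1 - x₀) 1 C) (Ω ×ˢ Icc 0 T) :=
      ContinuousOn.add (by fun_prop) h1
    have h3 := h2 (x₀, t₀) ⟨hx₀, ht₀I⟩
    refine h3.eventually (lt_mem_nhds ?_)
    simpa using hlamF
  have hU : {Q : E N × ℝ | Q.1 ∈ Ω ∧ 0 < Q.2 ∧ (Q.2 = T → t₀ = T) ∧
      ‖Q.1 - x₀‖ ^ 2 + (Q.2 - t₀) ^ 2 < (r₀ / 2) ^ 2 ∧ 0 < lam + 2 * A * (Q.2 - t₀) ∧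
      (Q ∈ Ω ×ˢ Icc 0 T → 0 < lam + 2 * A * (Q.2 - t₀) + F Q.1 Q.2 (Q.1 - x₀) 1 C)}
      ∈ nhds (x₀, t₀) := by
    have h1 : ∀ᶠ Q in nhds (x₀, t₀), Q.1 ∈ Ω :=
      continuous_fst.continuousAt.eventually_mem (hΩ.mem_nhds hx₀)
    have h2 : ∀ᶠ Q : E N × ℝ in nhds (x₀, t₀), 0 < Q.2 :=
      continuous_snd.continuousAt.eventually_mem (Ioi_mem_nhds ht₀.1)
    -- The final time can occur only when `t₀ = T`, where the subsolution inequality is assumed.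
    have h3 : ∀ᶠ Q : E N × ℝ in nhds (x₀, t₀), (Q.2 = T → t₀ = T) := by
      by_cases h : t₀ = T
      · exact Filter.Eventually.of_forall fun _ _ => h
      · have : ∀ᶠ Q : E N × ℝ in nhds (x₀, t₀), Q.2 ≠ T :=
          continuous_snd.continuousAt.eventually_ne h
        filter_upwards [this] with Q hQ hQ' using absurd hQ' hQ
    have h4 : ∀ᶠ Q : E N × ℝ in nhds (x₀, t₀),
        ‖Q.1 - x₀‖ ^ 2 + (Q.2 - t₀) ^ 2 < (r₀ / 2) ^ 2 := by
      have : Continuous fun Q : E N × ℝ => ‖Q.1 - x₀‖ ^ 2 + (Q.2 - t₀) ^ 2 := by fun_prop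
      refine this.continuousAt.eventually (gt_mem_nhds ?_)
      simpa using by positivity
    have h5 : ∀ᶠ Q : E N × ℝ in nhds (x₀, t₀), 0 < lam + 2 * A * (Q.2 - t₀) := by
      have : Continuous fun Q : E N × ℝ => lam + 2 * A * (Q.2 - t₀) := by fun_prop
      refine this.continuousAt.eventually (lt_mem_nhds ?_)
      simpa using hlam
    filter_upwards [h1, h2, h3, h4, h5, hG] with Q a b c d e f using ⟨a, b, c, d, e, f⟩
  obtain ⟨ε₁, hε₁, Hmax⟩ := exists_isMaxOn_sub_mul (P := (x₀, t₀)) husc hvC.continuous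
    (mk_mem_prod (mem_univ _) ht₀I) (fun Q hQ => hmax Q.1 Q.2 hQ.2) (by simp [capBarrier])
    (by
      refine IsCompact.of_isClosed_subset ((isCompact_closedBall x₀ r).prod
        (isCompact_Icc (a := (0 : ℝ)) (b := T)))
        (hcl.inter (isClosed_le hvC.continuous continuous_const)) ?_
      exact fun Q hQ => ⟨mem_closedBall_iff_norm.2 (hvneg Q hQ.2).1.le, hQ.1.2⟩)
    (by
      rintro ⟨y, τ⟩ hQ hvQ huQ
      obtain ⟨h1, h2, h3⟩ := hvneg _ hvQ
      rcases h3.lt_or_eq with h | h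
      · exact absurd huQ (hno y τ h1 h2 h)
      · simp only at h
        subst h
        have h4 : 1 ≤ Real.exp (-(1 / 2) * ‖y - x₀‖ ^ 2) := by
          simpa [capBarrier] using hvQ
        rw [Real.one_le_exp_iff] at h4
        have h5 : ‖y - x₀‖ ^ 2 = 0 := le_antisymm (by linarith) (sq_nonneg _)
        rw [pow_eq_zero_iff two_ne_zero, norm_eq_zero, sub_eq_zero] at h5
        rw [h5])
    hU
  obtain ⟨ε, hε, hεε₁, hεε₀⟩ : ∃ ε > 0, ε < ε₁ ∧ ε < ε₀ :=
    ⟨min ε₁ ε₀ / 2, by positivity, (half_lt_self (by positivity)).trans_le (min_le_left _ _),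
      (half_lt_self (by positivity)).trans_le (min_le_right _ _)⟩
  obtain ⟨⟨y, τ⟩, ⟨hSQ, hyΩ, hτ0, hτT, hclose, hlampos, hFpos⟩, hQmax⟩ := Hmax ε hε hεε₁
  simp only at hyΩ hτ0 hτT hclose hlampos
  have hτI : τ ∈ Icc 0 T := hSQ.2
  replace hFpos := hFpos ⟨hyΩ, hτI⟩
  simp only at hFpos
  have hφC : ContDiff ℝ 2 fun Q => ε * capBarrier x₀ t₀ lam A Q := contDiff_const.mul hvC
  -- With `κ = 1` and the empty set as cone, no concavity gain is taken: (N') needs only the bound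
  -- `C`.
  obtain ⟨l, hl, hineq⟩ := (hsub y hyΩ τ ⟨hτ0, hτI.2⟩ hτT).exists_le_of_gaussProfile hM hyΩ hτI hC
    hδ hφC (fun y' s' hs' => hQmax (y', s') ⟨mem_univ _, hs'⟩)
    (mul_capBarrier_eq_gaussProfile x₀ t₀ lam A ε τ) hε.le le_rfl MeasurableSet.empty
    (by simp) (by simp) (by simp)
  rw [deriv_mul_capBarrier] at hineq
  obtain ⟨p, hp⟩ : ∃ p, p = y - x₀ := ⟨_, rfl⟩
  obtain ⟨e, he⟩ : ∃ e, e = ε * 1 * Real.exp (-(1 / 2) * ‖p‖ ^ 2) := ⟨_, rfl⟩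
  rw [← hp, ← he] at hl hineq
  rw [← hp] at hclose hFpos
  have he0 : 0 < e := by rw [he]; positivity
  have heε : e ≤ ε := by
    rw [he, mul_one]
    exact mul_le_of_le_one_right hε.le (Real.exp_le_one_iff.2
      (mul_nonpos_of_nonpos_of_nonneg (by norm_num) (by positivity)))
  have hle : l ≤ e * C := by simpa using hl
  have hpr : ‖p‖ ≤ r₀ / 2 := by
    refine (pow_le_pow_iff_left₀ (by positivity) (by positivity) two_ne_zero).1 ?_
    have := sq_nonneg (τ - t₀)
    linarith
  -- Discards `-p ⊗ p`. Here `p` may vanish, hence the extended form of ellipticity.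
  have hE1 := hE.le_of_posSemidef hyΩ hτI (e • p) (X := e • (1 : Mat N))
    (Y := e • (1 - (1 : ℝ) • tensorSq p)) (Matrix.isSymm_one.smul e)
    ((isSymm_one_sub_smul_tensorSq 1 p).smul e)
    (by
      rw [← smul_sub, sub_sub_cancel, one_smul]
      exact (posSemidef_tensorSq p).smul he0.le) hle
  rw [hp] at hclose
  have hS1 := HS e he0 (heε.trans_lt hεε₀) (r₀ / 2) (by positivity) (by linarith) y hyΩ τ hτI
    hclose p hpr C le_rfl
  -- The time derivative carries `ε` and the rest carries `e ≤ ε`; positivity of the bracket lets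
  -- `e` be factored throughout.
  have h1 : e * (lam + 2 * A * (τ - t₀)) ≤ ε * (lam + 2 * A * (τ - t₀)) :=
    mul_le_mul_of_nonneg_right heε hlampos.le
  have h2 := mul_pos he0 hFpos
  rw [mul_add] at h2
  linarith

end Vertical

/-! ### What the curve provides. -/

section Reachable

variable {N : ℕ} {Ω : Set (E N)} {T : ℝ}

lemma fst_mem_connectedComponentIn_of_mem_pastReachable {P₀ Q : E N × ℝ}
    (hP₀ : P₀ ∈ cylinder Ω T) (hQ : Q ∈ pastReachable Ω T P₀) :
    Q.1 ∈ connectedComponentIn Ω P₀.1 ∧ Q.2 ∈ Ioc 0 P₀.2 := by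
  rcases hQ with rfl | ⟨c, hc, -, hmaps, rfl, rfl, hmono⟩
  · exact ⟨mem_connectedComponentIn hP₀.1, hP₀.2.1, le_rfl⟩
  · have h0 : (0 : ℝ) ∈ Icc (0 : ℝ) 1 := ⟨le_rfl, zero_le_one⟩
    have h1 : (1 : ℝ) ∈ Icc (0 : ℝ) 1 := ⟨zero_le_one, le_rfl⟩
    refine ⟨?_, (hmaps h0).2.1, hmono h0 h1 zero_le_one⟩
    have hpre : IsPreconnected ((fun s => (c s).1) '' Icc 0 1) :=
      isPreconnected_Icc.image _ (continuous_fst.comp_continuousOn hc)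
    refine hpre.subset_connectedComponentIn (mem_image_of_mem _ h1) ?_ (mem_image_of_mem _ h0)
    rintro _ ⟨s, hs, rfl⟩
    exact (hmaps hs).1

end Reachable

end NonlocalSMP

/-! ### The strong maximum principle. -/

open NonlocalSMP in
theorem mainTheorem1 {N : ℕ} (hN : 1 ≤ N) (Ω : Set (NonlocalSMP.E N)) (hΩ : IsOpen Ω)
    (T : ℝ) (hT : 0 < T)
    (μ : NonlocalSMP.E N → MeasureTheory.Measure (NonlocalSMP.E N)) (C : ℝ) (hC : 0 < C)
    (hM : NonlocalSMP.CondM Ω μ C)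
    (F : NonlocalSMP.Nonlinearity N)
    (hE : NonlocalSMP.CondE Ω T F)
    (hS : NonlocalSMP.CondS Ω T F) (hS' : NonlocalSMP.CondS' Ω T C F)
    (hNd : NonlocalSMP.CondN Ω T μ C F) (hNd' : NonlocalSMP.CondN' Ω T C F)
    (δ : ℝ) (hδ₀ : 0 < δ) (hδ₁ : δ < 1)
    (u : NonlocalSMP.E N × ℝ → ℝ)
    (hu : NonlocalSMP.IsViscositySubsolution F μ Ω T δ u)
    (x₀ : NonlocalSMP.E N) (t₀ : ℝ) (hP₀ : (x₀, t₀) ∈ NonlocalSMP.cylinder Ω T)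
    (hmax : ∀ y : NonlocalSMP.E N, ∀ s ∈ Set.Icc 0 T, u (y, s) ≤ u (x₀, t₀))
    (hfinal : t₀ = T → ∀ x ∈ Ω, NonlocalSMP.IsSubsolutionAt F μ T δ u x T) :
    ∀ Q ∈ NonlocalSMP.pastReachable Ω T (x₀, t₀), u Q = u (x₀, t₀) := by
  have : NeZero N := ⟨by omega⟩
  rintro ⟨x, t⟩ hQ
  obtain ⟨hxZ, ht⟩ := fst_mem_connectedComponentIn_of_mem_pastReachable hP₀ hQ
  simp only at hxZ ht
  have ht₀ : t₀ ∈ Ioc 0 T := hP₀.2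
  have hx₀ : x₀ ∈ Ω := hP₀.1
  obtain ⟨M, hMu⟩ : ∃ M, M = u (x₀, t₀) := ⟨_, rfl⟩
  rw [← hMu] at hmax ⊢
  set Z := connectedComponentIn Ω x₀
  have hZΩ : Z ⊆ Ω := connectedComponentIn_subset Ω x₀
  have hZo : IsOpen Z := hΩ.connectedComponentIn
  have hx₀Z : x₀ ∈ Z := mem_connectedComponentIn hx₀
  have hclosed : ∀ y : E N, IsCompact (Icc t t₀ ∩ {s | M ≤ u (y, s)}) := by
    intro y
    have h : UpperSemicontinuousOn (fun s => u (y, s)) (Icc t t₀) :=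
      hu.usc.comp (f := u) (g := fun s : ℝ => (y, s))
        (Continuous.prodMk_right y).continuousOn
        fun s hs => ⟨mem_univ _, ht.1.le.trans hs.1, hs.2.trans ht₀.2⟩
    exact UpperSemicontinuousOn.isCompact_inter_preimage_Ici h isCompact_Icc M
  -- One step back in time, then spreading over all of `Z`; the step lands strictly below `T`, where
  -- spreading is available.
  have hearlier : ∀ y ∈ Z, ∀ s ∈ Ioc 0 t₀, u (y, s) = M → ∀ s' < s, 0 < s' →
      ∃ τ ∈ Ioo s' s, ∀ z ∈ Z, u (z, τ) = M := by
    intro y hy s hs huy s' hs' hs'0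
    obtain ⟨r, hr, hrZ⟩ := Metric.isOpen_iff.1 hZo y hy
    obtain ⟨z, τ, hz, hτ, hτs, huz⟩ := exists_earlier_max hΩ hC.le hM hE hS' hNd' hδ₁ hu.usc
      (hZΩ hy) (t₀ := s) ⟨hs.1, hs.2.trans ht₀.2⟩
      (fun z hz τ hτ hτT => by
        rcases hτ.2.lt_or_eq with h | h
        · exact hu.subsolutionAt z hz τ ⟨hτ.1, h⟩
        · have h1 := hτT h
          rw [h]
          exact hfinal (le_antisymm ht₀.2 (h1 ▸ hs.2)) z hz)
      (fun z τ hτ => (hmax z τ hτ).trans_eq huy.symm) (r := min r (s - s'))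
      (lt_min hr (by linarith))
    have h1 : s' < τ := by linarith [min_le_right r (s - s')]
    refine ⟨τ, ⟨h1, hτs⟩, eq_max_of_isPreconnected hΩ hC.le hM hE hS hNd hδ₁ hu
      ⟨hs'0.trans h1, hτs.trans_le (hs.2.trans ht₀.2)⟩ hmax isPreconnected_connectedComponentIn hZΩ
      (hrZ (mem_ball_iff_norm.2 (hz.trans_le (min_le_left _ _)))) (huz.trans huy)⟩
  have hleast : u (x₀, t) = M := by
    obtain ⟨b, ⟨hbI, hbM⟩, hb⟩ := (hclosed x₀).exists_isLeast ⟨t₀, ⟨ht.2, le_rfl⟩, hMu.le⟩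
    have hbM' : u (x₀, b) = M :=
      le_antisymm (hmax _ _ ⟨ht.1.le.trans hbI.1, hbI.2.trans ht₀.2⟩) hbM
    rcases hbI.1.lt_or_eq with h | h
    · obtain ⟨τ, hτ, hτM⟩ := hearlier x₀ hx₀Z b ⟨ht.1.trans h, hbI.2⟩ hbM' t h ht.1
      have := hb ⟨⟨hτ.1.le, hτ.2.le.trans hbI.2⟩, (hτM x₀ hx₀Z).ge⟩
      exact absurd hτ.2 (not_lt.2 this)
    · rw [h, hbM']
  rcases (ht.2.trans ht₀.2).lt_or_eq with h | h
  · exact eq_max_of_isPreconnected hΩ hC.le hM hE hS hNd hδ₁ hu ⟨ht.1, h⟩ hmax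
      isPreconnected_connectedComponentIn hZΩ hx₀Z hleast x hxZ
  -- Case `t = t₀ = T`: spreading is unavailable at the final time, but `u = M` on `Z` at times
  -- increasing to `T`, and upper semicontinuity passes to the limit.
  · by_contra hne
    have htI : t ∈ Icc 0 T := ⟨ht.1.le, h.le⟩
    have h1 := hu.usc (x, t) ⟨mem_univ _, htI⟩ M (lt_of_le_of_ne (hmax x t htI) hne)
    rw [eventually_nhdsWithin_iff] at h1
    have h2 : ∀ᶠ s in nhds t, (x, s) ∈ univ ×ˢ Icc 0 T → u (x, s) < M :=
      ((Continuous.prodMk_right x).tendsto t).eventually h1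
    obtain ⟨s', hs', hs'M⟩ := exists_Ioc_subset_of_mem_nhds (h2.and (lt_mem_nhds ht.1)) ⟨0, ht.1⟩
    -- The midpoint of `max s' 0` and `t` is positive, above `s'` and below `t`.
    obtain ⟨τ, hτ, hτM⟩ := hearlier x₀ hx₀Z t ht hleast (max s' 0 / 2 + t / 2)
      (by linarith [max_lt hs' ht.1]) (by linarith [le_max_right s' 0, ht.1])
    have hτs' : τ ∈ Ioc s' t := by
      refine ⟨?_, hτ.2.le⟩
      linarith [hτ.1, max_lt hs' ht.1, le_max_left s' 0]
    have h3 := hs'M hτs'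
    exact (h3.1 ⟨mem_univ _, h3.2.le, hτ.2.le.trans h.le⟩).ne (hτM x hxZ)
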